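/- Let $n\ge 1$, $m\ge n$, let $q\in\mathbb C$ with $0<|q|<1$, and let $\alpha_1,\dots,\alpha_m\in\mathbb C^*$ be pairwise distinct with $\alpha_i\notin\alpha_jq^{\mathbb Z\setminus\{0\}}$ for all $i,j$, and $\alpha_j\notin q^{\mathbb Z}$ for all $j$. Notation. Let $K=K(\mathbb P^{n-1})\otimes\mathbb C=\mathbb C[P]/((1-P)^n)$ with its topology as a finite-dimensional complex vector space, where $P=\mathcal O(-1)$. Write $(a;q)_d=\prod_{k=0}^{d-1}(1-aq^k)$ for $d\in\mathbb N\cup\{\infty\}$ and $(a_1,\dots,a_r;q)_\infty=\prod_i(a_i;q)_\infty$. Put $\theta_q(Q)=\sum_{d\in\mathbb Z}q^{d(d-1)/2}Q^d$, $e_{q,\lambda}(Q)=\theta_q(Q)/\theta_q(\lambda Q)$, $l_q(Q)=-Q\theta_q'(Q)/\theta_q(Q)$, and $P^{l}=\sum_{k=0}^{n-1}\binom{l}{k}(P-1)^k$ for $l \in \mathbb C$. For $1\le j\le m$ consider the power series $$\widetilde W_j(w)=\sum_{d\ge0}\frac{\prod_{k=0}^{d-1}(1-\alpha_j^{-1}q^{-k})^n}{\prod_{i=1}^m\prod_{k=1}^d\bigl(1-\tfrac{\alpha_i}{\alpha_j}q^{-k}\bigr)}\,w^d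 .$$ It converges on all of $\mathbb C$ if $m>n$. If $m=n$ it converges for $|w|<|q^{-n}\prod_i\alpha_i|$ and extends to a meromorphic function on $\mathbb C$, with poles at most at the points $w=q^{-n-k}\prod_i\alpha_i$, $k\ge0$. Denote the resulting function on $\mathbb C$ again by $\widetilde W_j$, and let $W_j(w)=e_{q,\alpha_j}(w)\,\widetilde W_j(w)$; these are the Frobenius solutions at $Q=\infty$ (with $w=1/Q$). Call $Q\in\mathbb C^*$ regular if $Q\notin q^{\mathbb Z}$, $Q\notin -q^{\mathbb Z}$, $Q\notin-\alpha_jq^{\mathbb Z}$ for all $j$, and, in the case $m=n$, also $Q\prod_i\alpha_i\ne q^{n+k}$ for all $k\ge 0$. Then the $K$-valued function $$R(Q)=P^{l_q(Q)}\frac{\prod_{i=1}^m(P\alpha_i;q)_\infty}{(Pq;q)_\infty^n}\sum_{j=1}^m\frac{\bigl(q,q,P\alpha_jQ,q/(P\alpha_jQ);q\bigr)_\infty}{\bigl(P\alpha_j,q/(P\alpha_j),Q,q/Q;q\bigr)_\infty}\cdot\frac{(\alpha_j^{-1}q;q)_\infty^n\;e_{q,\alpha_j}(1/Q)^{-1}}{\prod_{i\ne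 j}(\alpha_i/\alpha_j;q)_\infty\,(q;q)_\infty}\,W_j(1/Q)$$ is analytic at every regular $Q\in\mathbb C^*$. For every $0<\delta<\pi$ and every regular $Q$ with $|Q|<1$ and $|\arg(-Q)|<\pi-\delta$, the following series converges in $K$, and $$P^{l_q(Q)}\sum_{d=0}^\infty\frac{\prod_{i=1}^m(P\alpha_i;q)_d}{(Pq;q)_d^n}\,Q^d=R(Q).$$ Thus $R$ is an analytic continuation of the left-hand side. -/

import Mathlib

open Polynomial

noncomputable section

/-- The complexified K-ring of the projective space `ℙⁿ⁻¹`, in its standard presentation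
`ℂ[P] / ((1 - P)ⁿ)`, where `P` is the class of the tautological line bundle `𝒪(-1)`. -/
def KProj (n : ℕ) : Type := AdjoinRoot ((1 - X) ^ n : ℂ[X])

instance (n : ℕ) : CommRing (KProj n) :=
  inferInstanceAs (CommRing (AdjoinRoot ((1 - X) ^ n : ℂ[X])))

instance (n : ℕ) : Algebra ℂ (KProj n) :=
  inferInstanceAs (Algebra ℂ (AdjoinRoot ((1 - X) ^ n : ℂ[X])))

/-- The canonical topology of a finite-dimensional complex vector space. -/
instance (n : ℕ) : TopologicalSpace (KProj n) := moduleTopology ℂ (KProj n)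

instance (n : ℕ) : IsModuleTopology ℂ (KProj n) := ⟨rfl⟩

/-- The class `P = 𝒪(-1)`. -/
def KProj.P (n : ℕ) : KProj n := AdjoinRoot.root ((1 - X) ^ n : ℂ[X])

theorem KProj.one_sub_P_pow (n : ℕ) : (1 - KProj.P n) ^ n = 0 := by
  have h : AdjoinRoot.mk ((1 - X) ^ n : ℂ[X]) ((1 - X) ^ n) = 0 := AdjoinRoot.mk_self
  rw [map_pow, map_sub, map_one, AdjoinRoot.mk_X] at h
  exact h

theorem KProj.isUnit_P (n : ℕ) : IsUnit (KProj.P n) := by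
  have h : IsNilpotent (KProj.P n - 1) := by
    have h0 : IsNilpotent (1 - KProj.P n) := ⟨n, KProj.one_sub_P_pow n⟩
    simpa using h0.neg
  simpa using h.isUnit_add_one

/-- The inverse `P⁻¹` (the class of `𝒪(1)`). -/
def KProj.Pinv (n : ℕ) : KProj n := ((KProj.isUnit_P n).unit⁻¹ : (KProj n)ˣ)

theorem KProj.P_mul_Pinv (n : ℕ) : KProj.P n * KProj.Pinv n = 1 :=
  (KProj.isUnit_P n).mul_val_inv

/-- The finite `q`-Pochhammer symbol `(a;q)_d = ∏_{k<d} (1 - q^k a)`. -/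
def qPoch {A : Type*} [CommRing A] [Algebra ℂ A] (q : ℂ) (a : A) (d : ℕ) : A :=
  ∏ k ∈ Finset.range d, (1 - q ^ k • a)

/-- The infinite `q`-Pochhammer symbol `(a;q)_∞ = ∏_{k≥0} (1 - q^k a)`. -/
def qPochInf {A : Type*} [CommRing A] [Algebra ℂ A] [TopologicalSpace A] (q : ℂ) (a : A) : A :=
  ∏' k : ℕ, (1 - q ^ k • a)

/-- The Jacobi theta function `θ_q(Q) = ∑_{d ∈ ℤ} q^{d(d-1)/2} Q^d`. -/
def qTheta (q Q : ℂ) : ℂ := ∑' d : ℤ, q ^ (d * (d - 1) / 2) * Q ^ d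

/-- The `q`-character `e_{q,lam}(Q) = θ_q(Q) / θ_q(lam Q)`. -/
def qChar (q lam Q : ℂ) : ℂ := qTheta q Q / qTheta q (lam * Q)

/-- The `q`-logarithm `ℓ_q(Q) = -Q θ_q'(Q) / θ_q(Q)`. -/
def qLog (q Q : ℂ) : ℂ := -Q * deriv (qTheta q) Q / qTheta q Q

/-- `P^l = (1 + (P - 1))^l = ∑_k binom(l,k) (P - 1)^k` for a complex exponent `l`; the sum
stops at `k = n - 1` since `(1 - P)^n = 0`. -/
def KProj.Pcpow (n : ℕ) (l : ℂ) : KProj n :=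
  ∑ k ∈ Finset.range n,
    ((∏ r ∈ Finset.range k, (l - (r : ℂ))) / (k.factorial : ℂ)) • (KProj.P n - 1) ^ k

/-- The `d`-th term `∏_i (P α_i;q)_d / (Pq;q)_d^n · Q^d`. The denominator is a unit when
`0 < |q| < 1`. -/
def qSeriesTerm (n : ℕ) {m : ℕ} (q : ℂ) (α : Fin m → ℂ) (Q : ℂ) (d : ℕ) : KProj n :=
  Q ^ d • ((∏ i, qPoch q (α i • KProj.P n) d) * Ring.inverse (qPoch q (q • KProj.P n) d ^ n))

/-- The coefficients
`∏_{k=0}^{d-1} (1 - α_j⁻¹ q^{-k})^n / ∏_i ∏_{k=1}^d (1 - (α_i/α_j) q^{-k})`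
of the Frobenius solution `W_j` at `Q = ∞`. -/
def frobeniusCoeff (n : ℕ) {m : ℕ} (q : ℂ) (α : Fin m → ℂ) (j : Fin m) (d : ℕ) : ℂ :=
  (∏ k ∈ Finset.range d, (1 - (α j)⁻¹ * (q ^ k)⁻¹) ^ n) /
    ∏ i, ∏ k ∈ Finset.Icc 1 d, (1 - α i / α j * (q ^ k)⁻¹)

/-- `G` is the meromorphic function on `ℂ` given by the power series
`∑_d frobeniusCoeff n q α j d * w^d`. For `n < m` the series converges everywhere.
For `m = n` it converges only for `|w| < |∏ α_i / q^n|`, and `G` is its meromorphic continuation,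
with poles at most at the points `w = (∏ α_i) q^{-n-k}`, `k ≥ 0`. -/
structure IsFrobeniusFactor (n : ℕ) {m : ℕ} (q : ℂ) (α : Fin m → ℂ) (j : Fin m)
    (G : ℂ → ℂ) : Prop where
  hasSum : ∀ w : ℂ, (n < m ∨ ‖w‖ * ‖q‖ ^ n < ‖∏ i, α i‖) →
    HasSum (fun d : ℕ => frobeniusCoeff n q α j d * w ^ d) (G w)
  meromorphicAt : ∀ w : ℂ, MeromorphicAt G w
  analyticAt : ∀ w : ℂ, (m = n → ∀ k : ℕ, w * q ^ (n + k) ≠ ∏ i, α i) → AnalyticAt ℂ G w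

/-- The Frobenius solution `W_j(w) = e_{q,α_j}(w) · G_j(w)`, where `w = 1/Q` is the coordinate
at `Q = ∞` and `G_j` is the (continued) power series of `IsFrobeniusFactor`. -/
def frobeniusSol {m : ℕ} (q : ℂ) (α : Fin m → ℂ) (G : Fin m → ℂ → ℂ) (j : Fin m) (w : ℂ) : ℂ :=
  qChar q (α j) w * G j w

/-- The factor
`(q, q, Pα_jQ, q/(Pα_jQ); q)_∞ / (Pα_j, q/(Pα_j), Q, q/Q; q)_∞`, an element of the K-ring. -/
def thetaFactor (n : ℕ) (q a Q : ℂ) : KProj n :=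
  (qPochInf q q ^ 2 / (qPochInf q Q * qPochInf q (q / Q))) •
    (qPochInf q ((a * Q) • KProj.P n) * qPochInf q ((q / (a * Q)) • KProj.Pinv n) *
      Ring.inverse (qPochInf q (a • KProj.P n) * qPochInf q ((q / a) • KProj.Pinv n)))

/-- The scalar factor
`(α_j⁻¹ q;q)_∞^n e_{q,α_j}(1/Q)⁻¹ / (∏_{i≠j} (α_i/α_j;q)_∞ (q;q)_∞)`. -/
def scalarFactor (n : ℕ) {m : ℕ} (q : ℂ) (α : Fin m → ℂ) (j : Fin m) (Q : ℂ) : ℂ :=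
  qPochInf q ((α j)⁻¹ * q) ^ n * (qChar q (α j) Q⁻¹)⁻¹ /
    ((∏ i ∈ Finset.univ.erase j, qPochInf q (α i / α j)) * qPochInf q q)

/-- The combination of the Frobenius solutions at `Q = ∞`:
`P^{ℓ_q(Q)} ∏_i (Pα_i;q)_∞ / (Pq;q)_∞^n ∑_j thetaFactor_j · scalarFactor_j · W_j(1/Q)`. -/
def infinitySide (n : ℕ) {m : ℕ} (q : ℂ) (α : Fin m → ℂ) (G : Fin m → ℂ → ℂ) (Q : ℂ) :
    KProj n :=
  KProj.Pcpow n (qLog q Q) *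
    ((∏ i, qPochInf q (α i • KProj.P n)) * Ring.inverse (qPochInf q (q • KProj.P n) ^ n)) *
    ∑ j, (scalarFactor n q α j Q * frobeniusSol q α G j Q⁻¹) • thetaFactor n q (α j) Q

/-- `Q` lies in `ℂ^*` off the zeros and poles of the functions that occur in the formula:
`Q ∉ q^ℤ` (zeros of `(Q, q/Q;q)_∞`), `Q ∉ -q^ℤ` (poles of `ℓ_q`), `Q ∉ -α_j q^ℤ` (zeros of
`θ_q(α_j/Q)`) and, for `m = n` only, `1/Q` is not a pole of a continued Frobenius series. -/
def IsRegularPoint (n : ℕ) {m : ℕ} (q : ℂ) (α : Fin m → ℂ) (Q : ℂ) : Prop :=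
  Q ≠ 0 ∧ (∀ k : ℤ, Q ≠ q ^ k) ∧ (∀ k : ℤ, Q ≠ -q ^ k) ∧ (∀ j, ∀ k : ℤ, Q ≠ -(α j * q ^ k)) ∧
    (m = n → ∀ k : ℕ, Q * ∏ i, α i ≠ q ^ (n + k))

end

open Filter Topology

/-! ### The infinite `q`-Pochhammer symbol -/

/-! Replace $P$ by a complex variable $x$ and extend the series at $Q=0$ to a bilateral sum over
$d\in\mathbb Z$. Multiplied by suitable Pochhammer products, it becomes a function of $x$,
holomorphic on $\mathbb C^*$, which $x\mapsto qx$ multiplies by $Q^{-1}\prod_i(-(x\alpha_i)^{-1})$.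
At $x=\alpha_j^{-1}$ the part with $d>0$ drops out, and what remains is the Frobenius series
$\widetilde W_j(1/Q)$ up to an explicit factor. The sum over $j$ of these values times
$\theta(x\alpha_jQ)\prod_{i\ne j}\theta(x\alpha_i)$, suitably normalized, where
$\theta(a)=(a,q/a;q)_\infty$, has the same multiplier and interpolates the same values.

The difference vanishes on every $\alpha_j^{-1}q^{\mathbb Z}$. Dividing it by all the
$\theta(x\alpha_i)$, whose zeros are simple and disjoint, leaves a function with constant multiplier
$Q^{-1}\notin q^{\mathbb Z}$, and Liouville's theorem makes it zero
(`eq_zero_of_theta_quasiperiodic`). This gives `bilateralSum_eq_thetaSum`.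

To return to $P$, take Taylor polynomials at $x=1$ (`KProj.evalAt`). The part with $d<0$ carries the
factor $(1-x^{-1})^n$, which is killed at $x=P$ (`KProj.evalAt_bilateralSum`), so only the original
series survives; `KProj.hasSum_qSeriesTerm_infinitySide` matches the constants.

Both halves of the sum are entire solutions of $T(t)=\varphi(t)+z\,p(t)\,T(qt)$. Solving this
equation beyond the disc where the iteration series converges (`exists_isEntireQSol`) gives the
meromorphic continuation in the case $m=n$, and `qIterTerm_frob` shows that one function $T$ yields
every $\widetilde W_j$, by evaluation at $t=\alpha_j$. -/

theorem hasProdLocallyUniformlyOn_qPochInf {q : ℂ} (hq1 : ‖q‖ < 1) :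
    HasProdLocallyUniformlyOn (fun (k : ℕ) (a : ℂ) => 1 - q ^ k • a) (qPochInf q) Set.univ := by
  have key : ∀ R : ℝ, HasProdLocallyUniformlyOn (fun (k : ℕ) (a : ℂ) => 1 + -(q ^ k • a))
      (fun a => ∏' k : ℕ, (1 + -(q ^ k • a))) (Metric.ball 0 R) := fun R => by
    refine Summable.hasProdLocallyUniformlyOn_one_add (u := fun k : ℕ => ‖q‖ ^ k * R)
      Metric.isOpen_ball ((summable_geometric_of_lt_one (norm_nonneg _) hq1).mul_right R) ?_ ?_
    · refine Eventually.of_forall fun k x hx => ?_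
      rw [norm_neg, norm_smul, norm_pow]
      have : ‖x‖ < R := by simpa using hx
      gcongr
    · intro k
      fun_prop
  simp only [← sub_eq_add_neg] at key
  intro v hv x _
  obtain ⟨t, ht, h⟩ := key (‖x‖ + 1) v hv x (by simp)
  rw [Metric.isOpen_ball.nhdsWithin_eq (by simp)] at ht
  exact ⟨t, mem_nhdsWithin_of_mem_nhds ht, h⟩

theorem hasProd_qPochInf {q : ℂ} (hq1 : ‖q‖ < 1) (a : ℂ) :
    HasProd (fun k : ℕ => 1 - q ^ k • a) (qPochInf q a) :=
  (hasProdLocallyUniformlyOn_qPochInf hq1).hasProd (Set.mem_univ a)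

theorem differentiable_qPochInf {q : ℂ} (hq1 : ‖q‖ < 1) :
    Differentiable ℂ (qPochInf q : ℂ → ℂ) := by
  rw [← differentiableOn_univ]
  refine TendstoLocallyUniformlyOn.differentiableOn (hasProdLocallyUniformlyOn_qPochInf hq1)
    (Eventually.of_forall fun s => ?_) isOpen_univ
  fun_prop

theorem qPochInf_eq_mul {q : ℂ} (hq1 : ‖q‖ < 1) (a : ℂ) :
    qPochInf q a = (1 - a) * qPochInf q (q * a) := by
  have h : ∀ k : ℕ, 1 - q ^ k • (q * a) = 1 - q ^ (k + 1) • a := fun k => by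
    simp only [smul_eq_mul]; ring
  have hm := (hasProd_qPochInf hq1 (q * a)).multipliable
  simp only [h] at hm
  have := tprod_eq_zero_mul' (f := fun k : ℕ => 1 - q ^ k • a) hm
  simpa only [qPochInf, h, pow_zero, one_smul] using this

theorem qPochInf_eq_qPoch_mul {q : ℂ} (hq1 : ‖q‖ < 1) (a : ℂ) (d : ℕ) :
    qPochInf q a = qPoch q a d * qPochInf q (q ^ d * a) := by
  induction d with
  | zero => simp [qPoch]
  | succ d ih =>
    rw [ih, qPoch, qPoch, Finset.prod_range_succ, qPochInf_eq_mul hq1 (q ^ d * a), pow_succ',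
      smul_eq_mul]
    ring_nf

theorem qPochInf_ne_zero {q : ℂ} (hq1 : ‖q‖ < 1) {a : ℂ} (ha : ∀ k : ℕ, q ^ k * a ≠ 1) :
    qPochInf q a ≠ 0 := by
  have := tprod_one_add_ne_zero_of_summable (f := fun k : ℕ => -(q ^ k • a))
    (fun k h => ha k (by
      rw [← sub_eq_add_neg, sub_eq_zero, smul_eq_mul] at h; exact h.symm)) (by
      simpa [norm_smul] using (summable_geometric_of_lt_one (norm_nonneg _) hq1).mul_right ‖a‖)
  simpa only [← sub_eq_add_neg] using! this

theorem qPochInf_self_ne_zero {q : ℂ} (hq1 : ‖q‖ < 1) : qPochInf q q ≠ 0 := by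
  refine qPochInf_ne_zero hq1 fun k h => ?_
  have := congrArg norm h
  rw [← pow_succ, norm_pow, norm_one] at this
  exact (pow_lt_one₀ (norm_nonneg _) hq1 k.succ_ne_zero).ne this

/-! ### The theta product: functional equation and simple zeros. -/

/-- The product form `(a, q/a; q)_∞` of the Jacobi theta function. -/
noncomputable def qJacobi (q a : ℂ) : ℂ := qPochInf q a * qPochInf q (q / a)

theorem qJacobi_mul_left {q : ℂ} (hq1 : ‖q‖ < 1) (hq0 : q ≠ 0) {a : ℂ} (ha : a ≠ 0) :
    qJacobi q (q * a) = -a⁻¹ * qJacobi q a := by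
  rw [qJacobi, qJacobi, qPochInf_eq_mul hq1 a, qPochInf_eq_mul hq1 (q / (q * a))]
  have h : q * (q / (q * a)) = q / a := by field_simp
  rw [h]
  field_simp
  ring

theorem qJacobi_ne_zero {q : ℂ} (hq1 : ‖q‖ < 1) (hq0 : q ≠ 0) {a : ℂ} (h0 : a ≠ 0)
    (ha : ∀ k : ℤ, a ≠ q ^ k) : qJacobi q a ≠ 0 := by
  refine mul_ne_zero (qPochInf_ne_zero hq1 fun k h => ha (-k) ?_)
    (qPochInf_ne_zero hq1 fun k h => ha (k + 1) ?_)
  · rw [zpow_neg, zpow_natCast]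
    exact eq_inv_of_mul_eq_one_right h
  · field_simp at h
    rw [← h, zpow_add₀ hq0, zpow_natCast, zpow_one]

theorem differentiableAt_qJacobi {q : ℂ} (hq1 : ‖q‖ < 1) {a : ℂ} (ha : a ≠ 0) :
    DifferentiableAt ℂ (qJacobi q) a := by
  have h := differentiable_qPochInf hq1
  have : DifferentiableAt ℂ (fun a => q / a) a := by fun_prop (disch := assumption)
  exact (h a).mul ((h _).comp a this)

theorem qJacobi_zpow {q : ℂ} (hq1 : ‖q‖ < 1) (hq0 : q ≠ 0) (k : ℤ) :
    qJacobi q (q ^ k) = 0 := by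
  induction k using Int.induction_on with
  | zero => simp [qJacobi, qPochInf_eq_mul hq1 1]
  | succ k ih =>
    rw [zpow_add₀ hq0, zpow_one, mul_comm, qJacobi_mul_left hq1 hq0 (zpow_ne_zero _ hq0), ih,
      mul_zero]
  | pred k ih =>
    have h := qJacobi_mul_left hq1 hq0 (zpow_ne_zero (-(k : ℤ) - 1) hq0)
    rw [← zpow_one_add₀ hq0, add_sub_cancel, ih] at h
    exact (mul_eq_zero.mp h.symm).resolve_left (by simp [zpow_ne_zero _ hq0])

theorem deriv_qJacobi_zpow_ne_zero {q : ℂ} (hq1 : ‖q‖ < 1) (hq0 : q ≠ 0) (k : ℤ) :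
    deriv (qJacobi q) (q ^ k) ≠ 0 := by
  -- Differentiating the functional equation at a zero leaves only one term, so simplicity
  -- propagates along $q^{\mathbb Z}$ in both directions.
  have step : ∀ k : ℤ, deriv (qJacobi q) (q ^ k) = -q ^ k * (q * deriv (qJacobi q) (q ^ (k + 1))) :=
    fun k => by
    have hk := zpow_ne_zero k hq0
    have e : qJacobi q =ᶠ[𝓝 (q ^ k)] fun a => -a * qJacobi q (q * a) := by
      filter_upwards [isOpen_ne.mem_nhds hk] with a ha
      rw [qJacobi_mul_left hq1 hq0 ha]
      have : a ≠ 0 := ha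
      field_simp
    have hk1 : q * q ^ k = q ^ (k + 1) := by rw [zpow_add₀ hq0, zpow_one, mul_comm]
    have hd : HasDerivAt (fun a => qJacobi q (q * a)) (q * deriv (qJacobi q) (q ^ (k + 1)))
        (q ^ k) := by
      have h1 := (differentiableAt_qJacobi hq1 (zpow_ne_zero (k + 1) hq0)).hasDerivAt
      rw [← hk1] at h1
      have h2 := h1.comp (q ^ k) ((hasDerivAt_id (q ^ k)).const_mul q)
      rw [hk1] at h2
      simpa [mul_comm, Function.comp_def] using h2
    rw [e.deriv_eq]
    refine ((hasDerivAt_id (q ^ k)).neg.mul hd).deriv.trans ?_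
    simp [hk1, qJacobi_zpow hq1 hq0]
  -- With the factor $1-a$ split off, the derivative at $1$ is $-(q;q)_\infty^2$.
  have h0 : deriv (qJacobi q) 1 ≠ 0 := by
    have e : qJacobi q = fun a => (1 - a) * (qPochInf q (q * a) * qPochInf q (q / a)) := by
      ext a; rw [qJacobi, qPochInf_eq_mul hq1 a, mul_assoc]
    have hd : DifferentiableAt ℂ (fun a : ℂ => qPochInf q (q * a) * qPochInf q (q / a)) 1 := by
      have h := differentiable_qPochInf hq1
      exact ((h _).comp (1 : ℂ) (by fun_prop)).mul
        ((h _).comp (f := fun a : ℂ => q / a) (1 : ℂ) (by fun_prop (disch := simp)))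
    rw [e]
    refine ((((hasDerivAt_id (1 : ℂ)).const_sub 1).mul hd.hasDerivAt).deriv).trans_ne ?_
    simpa using qPochInf_self_ne_zero hq1
  induction k using Int.induction_on with
  | zero => simpa using h0
  | succ k ih =>
    rw [step] at ih
    exact right_ne_zero_of_mul (right_ne_zero_of_mul ih)
  | pred k ih =>
    rw [step]
    simpa [hq0, zpow_ne_zero] using ih

/-! ### Entire solutions of first order `q`-difference equations -/

theorem exists_gt_mul_lt_one {a b : ℝ} (hb : 0 ≤ b) (h : a * b < 1) :
    ∃ a' > a, a' * b < 1 := by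
  refine ⟨a + (1 - a * b) / (b + 1), ?_, ?_⟩
  · have : 0 < (1 - a * b) / (b + 1) := div_pos (by linarith) (by linarith)
    linarith
  · rw [add_mul, div_mul_eq_mul_div]
    have : (1 - a * b) * b / (b + 1) < 1 - a * b := by
      rw [div_lt_iff₀ (by linarith)]
      nlinarith
    linarith

/-- `T` is an entire solution of the `q`-difference equation `T(t) = φ(t) + z p(t) T(q t)`. -/
structure IsEntireQSol (q : ℂ) (p φ : ℂ → ℂ) (z : ℂ) (T : ℂ → ℂ) : Prop where
  differentiable : Differentiable ℂ T
  eq : ∀ t, T t = φ t + z * p t * T (q * t)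

/-- The terms of the series solution of `T(t) = φ(t) + z p(t) T(q t)`. -/
def qIterTerm (q : ℂ) (p φ : ℂ → ℂ) (z t : ℂ) (d : ℕ) : ℂ :=
  z ^ d * ((∏ k ∈ Finset.range d, p (q ^ k * t)) * φ (q ^ d * t))

theorem qIterTerm_succ (q : ℂ) (p φ : ℂ → ℂ) (z t : ℂ) (d : ℕ) :
    qIterTerm q p φ z t (d + 1) = z * p t * qIterTerm q p φ z (q * t) d := by
  simp only [qIterTerm, Finset.prod_range_succ', pow_zero, one_mul, pow_succ, mul_assoc]
  ring

/-- Since $q^kt\to0$ uniformly for $\|t\|\le R$, all but finitely many factors $p(q^kt)$ are bounded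
by some $r>\|p(0)\|$ with $r\rho<1$, so a geometric majorant serves all such $z$ and $t$ at once. -/
theorem exists_summable_norm_qIterTerm_le {q : ℂ} (hq1 : ‖q‖ < 1) {p φ : ℂ → ℂ}
    (hp : Continuous p) (hφ : Continuous φ) {ρ : ℝ} (hρ : 0 ≤ ρ) (hρp : ρ * ‖p 0‖ < 1) (R : ℝ) :
    ∃ u : ℕ → ℝ, Summable u ∧ ∀ d z t, ‖z‖ ≤ ρ → ‖t‖ ≤ R → ‖qIterTerm q p φ z t d‖ ≤ u d := by
  obtain ⟨r, hr, hr1⟩ := exists_gt_mul_lt_one hρ (by rwa [mul_comm] at hρp)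
  have hr0 : 0 < r := (norm_nonneg _).trans_lt hr
  obtain ⟨M, hM⟩ := (isCompact_closedBall (0 : ℂ) R).exists_bound_of_continuousOn hp.continuousOn
  obtain ⟨Φ, hΦ⟩ := (isCompact_closedBall (0 : ℂ) R).exists_bound_of_continuousOn hφ.continuousOn
  obtain ⟨ε, hε, hεr⟩ : ∃ ε > 0, ∀ t : ℂ, ‖t‖ < ε → ‖p t‖ < r := by
    have := hp.norm.continuousAt.eventually (gt_mem_nhds hr)
    obtain ⟨ε, hε, h⟩ := Metric.eventually_nhds_iff.mp this
    exact ⟨ε, hε, fun t ht => h (by simpa using ht)⟩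
  obtain ⟨K, hK⟩ : ∃ K : ℕ, ∀ k ≥ K, ‖q‖ ^ k * R < ε := by
    have := (tendsto_pow_atTop_nhds_zero_of_lt_one (norm_nonneg q) hq1).mul_const R
    rw [zero_mul] at this
    exact eventually_atTop.mp (this.eventually (gt_mem_nhds hε))
  let b : ℕ → ℝ := fun k => if k < K then max M r else r
  have hb0 : ∀ k, 0 < b k := fun k => by
    dsimp only [b]; split_ifs
    exacts [lt_max_of_lt_right hr0, hr0]
  -- The maximum with $0$ keeps $u$ nonnegative even for $R<0$, when the ball is empty and `Φ` is
  -- arbitrary.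
  let u : ℕ → ℝ := fun d => ρ ^ d * ((∏ k ∈ Finset.range d, b k) * max Φ 0)
  have hu0 : ∀ d, 0 ≤ u d := fun d =>
    mul_nonneg (pow_nonneg hρ _) (mul_nonneg (Finset.prod_nonneg fun k _ => (hb0 k).le)
      (le_max_right _ _))
  refine ⟨u, ?_, fun d z t hz ht => ?_⟩
  · refine summable_of_ratio_norm_eventually_le (r := r * ρ) hr1 ?_
    filter_upwards [eventually_ge_atTop K] with d hd
    rw [Real.norm_of_nonneg (hu0 _), Real.norm_of_nonneg (hu0 _)]
    refine le_of_eq ?_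
    simp only [u, Finset.prod_range_succ, b, if_neg hd.not_gt, pow_succ]
    ring
  · have hball : ∀ k : ℕ, ‖q ^ k * t‖ ≤ ‖q‖ ^ k * R ∧ ‖q ^ k * t‖ ≤ R := fun k => by
      rw [norm_mul, norm_pow]
      refine ⟨by gcongr, (mul_le_of_le_one_left (norm_nonneg t) ?_).trans ht⟩
      exact pow_le_one₀ (norm_nonneg _) hq1.le
    rw [qIterTerm, norm_mul, norm_mul, norm_pow, norm_prod]
    have h1 : ∏ k ∈ Finset.range d, ‖p (q ^ k * t)‖ ≤ ∏ k ∈ Finset.range d, b k := by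
      refine Finset.prod_le_prod (fun _ _ => norm_nonneg _) fun k _ => ?_
      dsimp only [b]; split_ifs with hk
      · exact (hM _ (by simpa using (hball k).2)).trans (le_max_left _ _)
      · exact (hεr _ ((hball k).1.trans_lt (hK k (not_lt.mp hk)))).le
    have h2 : ‖φ (q ^ d * t)‖ ≤ max Φ 0 :=
      (hΦ _ (by simpa using (hball d).2)).trans (le_max_left _ _)
    have h3 : 0 ≤ ∏ k ∈ Finset.range d, b k := Finset.prod_nonneg fun k _ => (hb0 k).le
    dsimp only [u]
    gcongr

theorem summable_qIterTerm {q : ℂ} (hq1 : ‖q‖ < 1) {p φ : ℂ → ℂ} (hp : Continuous p)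
    (hφ : Continuous φ) {z : ℂ} (hz : ‖z‖ * ‖p 0‖ < 1) (t : ℂ) :
    Summable (qIterTerm q p φ z t) := by
  obtain ⟨u, hu, h⟩ := exists_summable_norm_qIterTerm_le hq1 hp hφ (norm_nonneg z) hz ‖t‖
  exact hu.of_norm_bounded fun d => h d z t le_rfl le_rfl

theorem isEntireQSol_tsum {q : ℂ} (hq1 : ‖q‖ < 1) {p φ : ℂ → ℂ} (hp : Differentiable ℂ p)
    (hφ : Differentiable ℂ φ) {z : ℂ} (hz : ‖z‖ * ‖p 0‖ < 1) :
    IsEntireQSol q p φ z (fun t => ∑' d, qIterTerm q p φ z t d) where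
  differentiable := fun t => by
    obtain ⟨u, hu, h⟩ := exists_summable_norm_qIterTerm_le hq1 hp.continuous hφ.continuous
      (norm_nonneg z) hz (‖t‖ + 1)
    refine (Complex.differentiableOn_tsum_of_summable_norm (U := Metric.ball 0 (‖t‖ + 1)) hu
      (fun d => ?_) Metric.isOpen_ball fun d w hw => h d z w le_rfl ?_).differentiableAt
      (Metric.isOpen_ball.mem_nhds (by simp))
    · unfold qIterTerm
      fun_prop
    · exact (by simpa using hw : ‖w‖ < ‖t‖ + 1).le
  eq := fun t => by
    rw [(summable_qIterTerm hq1 hp.continuous hφ.continuous hz t).tsum_eq_zero_add]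
    simp only [qIterTerm_succ, tsum_mul_left]
    simp [qIterTerm]

/-! ### Uniqueness, and existence for large $z$, by splitting off the value at $0$. -/

theorem differentiable_dslope {f : ℂ → ℂ} (hf : Differentiable ℂ f) (c : ℂ) :
    Differentiable ℂ (dslope f c) := by
  rw [← differentiableOn_univ] at hf ⊢
  exact (Complex.differentiableOn_dslope Filter.univ_mem).mpr hf

theorem eq_add_mul_dslope (f : ℂ → ℂ) (t : ℂ) : f t = f 0 + t * dslope f 0 t := by
  have := sub_smul_dslope f 0 t
  rw [sub_zero, smul_eq_mul] at this
  rw [this]; ring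

/-- For small $z$, iterating the equation writes $D(t)$ as the $d$-th term of a convergent series
for every $d$, so it is $0$. Otherwise non-resonance forces $D(0)=0$, and $D(t)/t$ solves the same
equation with $z$ replaced by $zq$; after $N$ such divisions $z$ is small. -/
theorem eq_zero_of_entire_qDifference {q : ℂ} (hq1 : ‖q‖ < 1) {p : ℂ → ℂ}
    (hp : Differentiable ℂ p) (N : ℕ) : ∀ {z : ℂ} {D : ℂ → ℂ}, ‖z‖ * ‖p 0‖ * ‖q‖ ^ N < 1 →
    (∀ i : ℕ, z * p 0 * q ^ i ≠ 1) → Differentiable ℂ D → (∀ t, D t = z * p t * D (q * t)) →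
    ∀ t, D t = 0 := by
  induction N with
  | zero =>
    intro z D hz _ hD h t
    have h1 : ∀ d : ℕ, ∀ t, qIterTerm q p D z t d = D t := fun d => by
      induction d with
      | zero => simp [qIterTerm]
      | succ d ih => intro t; rw [qIterTerm_succ, ih, ← h]
    have h2 := (summable_qIterTerm hq1 hp.continuous hD.continuous
      (by simpa using hz) t).tendsto_atTop_zero
    have h3 : qIterTerm q p D z t = fun _ => D t := funext fun d => h1 d t
    rw [h3] at h2
    exact tendsto_nhds_unique tendsto_const_nhds h2
  | succ N ih =>
    intro z D hz hzi hD h t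
    have hD0 : D 0 = 0 := by
      have := h 0
      rw [mul_zero] at this
      have h0 := hzi 0
      rw [pow_zero, mul_one] at h0
      by_contra hne
      exact h0 (mul_right_cancel₀ hne (by rw [← this, one_mul]))
    have hmul : ∀ t, D t = t * dslope D 0 t := fun t => by
      rw [eq_add_mul_dslope D t, hD0, zero_add]
    have hdD := differentiable_dslope hD 0
    have key : ∀ t, dslope D 0 t = 0 := by
      refine ih (z := z * q) ?_ ?_ hdD ?_
      · rw [norm_mul]
        calc _ = ‖z‖ * ‖p 0‖ * ‖q‖ ^ (N + 1) := by ring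
          _ < 1 := hz
      · intro i
        have := hzi (i + 1)
        rwa [pow_succ', show z * p 0 * (q * q ^ i) = z * q * p 0 * q ^ i by ring] at this
      -- Cancelling $t$ gives the equation only for $t\ne0$; continuity supplies the point $0$.
      · have hc : Continuous fun t => z * q * p t * dslope D 0 (q * t) := by
          have := hdD.continuous
          have := hp.continuous
          fun_prop
        refine congrFun (Continuous.ext_on (dense_compl_singleton (0 : ℂ)) hdD.continuous hc ?_)
        intro t ht
        have ht : t ≠ 0 := ht
        have := h t
        rw [hmul t, hmul (q * t)] at this
        refine mul_left_cancel₀ ht ?_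
        simp only
        rw [this]; ring
    rw [hmul, key, mul_zero]

theorem exists_pow_mul_lt_one {q : ℂ} (hq1 : ‖q‖ < 1) (a : ℝ) : ∃ N : ℕ, a * ‖q‖ ^ N < 1 := by
  have := (tendsto_pow_atTop_nhds_zero_of_lt_one (norm_nonneg q) hq1).const_mul a
  rw [mul_zero] at this
  exact (this.eventually (gt_mem_nhds one_pos)).exists

theorem IsEntireQSol.unique {q : ℂ} (hq1 : ‖q‖ < 1) {p φ : ℂ → ℂ}
    (hp : Differentiable ℂ p) {z : ℂ} (hz : ∀ i : ℕ, z * p 0 * q ^ i ≠ 1) {T₁ T₂ : ℂ → ℂ}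
    (h₁ : IsEntireQSol q p φ z T₁) (h₂ : IsEntireQSol q p φ z T₂) : T₁ = T₂ := by
  obtain ⟨N, hN⟩ := exists_pow_mul_lt_one hq1 (‖z‖ * ‖p 0‖)
  ext t
  refine sub_eq_zero.mp (eq_zero_of_entire_qDifference hq1 hp N (D := fun t => T₁ t - T₂ t) hN
    hz (h₁.differentiable.sub h₂.differentiable) (fun t => ?_) t)
  rw [h₁.eq t, h₂.eq t]; ring

/-- At $t=0$ the equation forces $T(0)=c=\varphi(0)/(1-zp(0))$. The quotient $(T(t)-c)/t$ then
solves the equation with parameter $zq$ and an inhomogeneity that combines the difference quotients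
of $\varphi$ and $p$, so by linearity it is $A+zcB$. -/
theorem IsEntireQSol.of_dslope {q : ℂ} {p φ : ℂ → ℂ} {z : ℂ} (hz : z * p 0 ≠ 1) {A B : ℂ → ℂ}
    (hA : IsEntireQSol q p (dslope φ 0) (z * q) A)
    (hB : IsEntireQSol q p (dslope p 0) (z * q) B) :
    IsEntireQSol q p φ z (fun t => φ 0 / (1 - z * p 0) +
      t * (A t + z * (φ 0 / (1 - z * p 0)) * B t)) where
  differentiable := by
    have := hA.differentiable
    have := hB.differentiable
    fun_prop
  eq := fun t => by
    have hc : φ 0 / (1 - z * p 0) = φ 0 + z * p 0 * (φ 0 / (1 - z * p 0)) := by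
      have : 1 - z * p 0 ≠ 0 := sub_ne_zero.mpr hz.symm
      field_simp
      ring
    set c := φ 0 / (1 - z * p 0)
    have e1 := eq_add_mul_dslope φ t
    have e2 := eq_add_mul_dslope p t
    rw [e1, hA.eq t, hB.eq t]
    linear_combination hc - z * c * e2

theorem exists_isEntireQSol {q : ℂ} (hq1 : ‖q‖ < 1) {p : ℂ → ℂ}
    (hp : Differentiable ℂ p) (N : ℕ) : ∀ {z : ℂ} {φ : ℂ → ℂ}, ‖z‖ * ‖p 0‖ * ‖q‖ ^ N < 1 →
    (∀ i : ℕ, z * p 0 * q ^ i ≠ 1) → Differentiable ℂ φ → ∃ T, IsEntireQSol q p φ z T := by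
  induction N with
  | zero => exact fun hz _ hφ => ⟨_, isEntireQSol_tsum hq1 hp hφ (by simpa using hz)⟩
  | succ N ih =>
    intro z φ hz hzi hφ
    have h1 : ‖z * q‖ * ‖p 0‖ * ‖q‖ ^ N < 1 := by
      rw [norm_mul]
      calc _ = ‖z‖ * ‖p 0‖ * ‖q‖ ^ (N + 1) := by ring
        _ < 1 := hz
    have h2 : ∀ i : ℕ, z * q * p 0 * q ^ i ≠ 1 := fun i => by
      have := hzi (i + 1)
      rwa [pow_succ', show z * p 0 * (q * q ^ i) = z * q * p 0 * q ^ i by ring] at this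
    obtain ⟨A, hA⟩ := ih h1 h2 (differentiable_dslope hφ 0)
    obtain ⟨B, hB⟩ := ih h1 h2 (differentiable_dslope hp 0)
    exact ⟨_, .of_dslope (by simpa using hzi 0) hA hB⟩

open Classical in
/-- The entire solution of `T(t) = φ(t) + z p(t) T(q t)`; it exists and is unique unless
`z p(0) q^i = 1` for some `i`. -/
noncomputable def entireQSol (q : ℂ) (p φ : ℂ → ℂ) (z : ℂ) : ℂ → ℂ :=
  if h : ∃ T, IsEntireQSol q p φ z T then h.choose else 0

theorem isEntireQSol_entireQSol {q : ℂ} (hq1 : ‖q‖ < 1) {p φ : ℂ → ℂ}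
    (hp : Differentiable ℂ p) (hφ : Differentiable ℂ φ) {z : ℂ}
    (hz : ∀ i : ℕ, z * p 0 * q ^ i ≠ 1) : IsEntireQSol q p φ z (entireQSol q p φ z) := by
  obtain ⟨N, hN⟩ := exists_pow_mul_lt_one hq1 (‖z‖ * ‖p 0‖)
  have h := exists_isEntireQSol hq1 hp N hN hz hφ
  rw [entireQSol, dif_pos h]
  exact h.choose_spec

theorem mul_pow_ne_one {q z a : ℂ} (hq1 : ‖q‖ < 1) (hz : ‖z‖ * ‖a‖ < 1) (i : ℕ) :
    z * a * q ^ i ≠ 1 := by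
  intro h
  have := congrArg norm h
  rw [norm_mul, norm_mul, norm_pow, norm_one] at this
  have h2 : ‖z‖ * ‖a‖ * ‖q‖ ^ i ≤ ‖z‖ * ‖a‖ :=
    mul_le_of_le_one_right (by positivity) (pow_le_one₀ (norm_nonneg _) hq1.le)
  linarith

theorem hasSum_entireQSol {q : ℂ} (hq1 : ‖q‖ < 1) {p φ : ℂ → ℂ}
    (hp : Differentiable ℂ p) (hφ : Differentiable ℂ φ) {z : ℂ} (hz : ‖z‖ * ‖p 0‖ < 1) (t : ℂ) :
    HasSum (qIterTerm q p φ z t) (entireQSol q p φ z t) := by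
  have hz' := mul_pow_ne_one hq1 hz
  rw [(isEntireQSol_entireQSol hq1 hp hφ hz').unique hq1 hp hz'
    (isEntireQSol_tsum hq1 hp hφ hz)]
  exact (summable_qIterTerm hq1 hp.continuous hφ.continuous hz t).hasSum

theorem entireQSol_eq_dslope {q : ℂ} (hq1 : ‖q‖ < 1) {p φ : ℂ → ℂ}
    (hp : Differentiable ℂ p) (hφ : Differentiable ℂ φ) {z : ℂ}
    (hz : ∀ i : ℕ, z * p 0 * q ^ i ≠ 1) (t : ℂ) :
    entireQSol q p φ z t = φ 0 / (1 - z * p 0) +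
      t * (entireQSol q p (dslope φ 0) (z * q) t +
        z * (φ 0 / (1 - z * p 0)) * entireQSol q p (dslope p 0) (z * q) t) := by
  have h2 : ∀ i : ℕ, z * q * p 0 * q ^ i ≠ 1 := fun i => by
    have := hz (i + 1)
    rwa [pow_succ', show z * p 0 * (q * q ^ i) = z * q * p 0 * q ^ i by ring] at this
  exact congrFun ((isEntireQSol_entireQSol hq1 hp hφ hz).unique hq1 hp hz
    (.of_dslope (by simpa using hz 0)
      (isEntireQSol_entireQSol hq1 hp (differentiable_dslope hφ 0) h2)
      (isEntireQSol_entireQSol hq1 hp (differentiable_dslope hp 0) h2))) t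

/-! ### Dependence of the entire solution on the parameter $z$. -/

/-- Near a given $z$ only finitely many $i$ can be resonant, and each excludes at most one point. -/
theorem eventually_mul_pow_ne_one {q : ℂ} (hq1 : ‖q‖ < 1) (a z : ℂ) :
    ∀ᶠ w in 𝓝[≠] z, ∀ i : ℕ, w * a * q ^ i ≠ 1 := by
  obtain ⟨N, hN⟩ := exists_pow_mul_lt_one hq1 (‖z‖ * ‖a‖)
  have h1 : ∀ᶠ w in 𝓝[≠] z, ‖w‖ * ‖a * q ^ N‖ < 1 := by
    refine eventually_nhdsWithin_of_eventually_nhds ?_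
    have hc : Continuous fun w : ℂ => ‖w‖ * ‖a * q ^ N‖ := by fun_prop
    refine hc.continuousAt.eventually (gt_mem_nhds ?_)
    simpa [mul_assoc] using hN
  have h2 : ∀ᶠ w in 𝓝[≠] z, ∀ i ∈ Finset.range N, w * a * q ^ i ≠ 1 := by
    rw [eventually_all_finset]
    intro i _
    by_cases hz : z * a * q ^ i = 1
    · filter_upwards [self_mem_nhdsWithin] with w hw h
      refine hw (mul_right_cancel₀ (b := a * q ^ i) ?_ ?_)
      · rintro h0
        rw [mul_assoc, h0, mul_zero] at hz
        exact zero_ne_one hz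
      · rw [← mul_assoc, ← mul_assoc, h, hz]
    · refine eventually_nhdsWithin_of_eventually_nhds ?_
      have hc : Continuous fun w : ℂ => w * a * q ^ i := by fun_prop
      exact hc.continuousAt.eventually_ne hz
  filter_upwards [h1, h2] with w hw1 hw2 i
  rcases lt_or_ge i N with hi | hi
  · exact hw2 i (Finset.mem_range.mpr hi)
  · obtain ⟨j, rfl⟩ := Nat.exists_eq_add_of_le hi
    have := mul_pow_ne_one hq1 hw1 j
    rwa [pow_add, ← mul_assoc, mul_assoc w a]

/-- For small $z$ the series converges uniformly in $z$. Each further step uses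
`entireQSol_eq_dslope`, which expresses the solution through solutions at $zq$ and adds only the
pole $zp(0)=1$. The induction varies $\varphi$ because the inhomogeneity changes at each step. -/
theorem meromorphicAt_and_analyticAt_entireQSol {q : ℂ} (hq1 : ‖q‖ < 1) {p : ℂ → ℂ}
    (hp : Differentiable ℂ p) (t : ℂ) (N : ℕ) : ∀ {φ : ℂ → ℂ} (z : ℂ), Differentiable ℂ φ →
    ‖z‖ * ‖p 0‖ * ‖q‖ ^ N < 1 → MeromorphicAt (fun w => entireQSol q p φ w t) z ∧
      ((∀ i : ℕ, z * p 0 * q ^ i ≠ 1) → AnalyticAt ℂ (fun w => entireQSol q p φ w t) z) := by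
  induction N with
  | zero =>
    intro φ z hφ hz
    obtain ⟨ρ, hρ, hρp⟩ := exists_gt_mul_lt_one (norm_nonneg (p 0))
      (by simpa using hz)
    obtain ⟨u, hu, h⟩ := exists_summable_norm_qIterTerm_le hq1 hp.continuous hφ.continuous
      ((norm_nonneg z).trans hρ.le) hρp ‖t‖
    have hd : DifferentiableOn ℂ (fun w => ∑' d, qIterTerm q p φ w t d) (Metric.ball 0 ρ) := by
      refine Complex.differentiableOn_tsum_of_summable_norm hu (fun d => ?_) Metric.isOpen_ball
        fun d w hw => h d w t ?_ le_rfl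
      · unfold qIterTerm
        fun_prop
      · exact (by simpa using hw : ‖w‖ < ρ).le
    have hmem : Metric.ball (0 : ℂ) ρ ∈ 𝓝 z := Metric.isOpen_ball.mem_nhds (by simpa using hρ)
    have ha : AnalyticAt ℂ (fun w => entireQSol q p φ w t) z := by
      refine (hd.analyticAt hmem).congr ?_
      filter_upwards [hmem] with w hw
      have hw : ‖w‖ < ρ := by simpa using hw
      refine (hasSum_entireQSol hq1 hp hφ (lt_of_le_of_lt ?_ hρp) t).tsum_eq
      gcongr
    exact ⟨ha.meromorphicAt, fun _ => ha⟩
  | succ N ih =>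
    intro φ z hφ hz
    have h1 : ‖z * q‖ * ‖p 0‖ * ‖q‖ ^ N < 1 := by
      rw [norm_mul]
      calc _ = ‖z‖ * ‖p 0‖ * ‖q‖ ^ (N + 1) := by ring
        _ < 1 := hz
    have h2 : (∀ i : ℕ, z * p 0 * q ^ i ≠ 1) → ∀ i : ℕ, z * q * p 0 * q ^ i ≠ 1 := fun hz i => by
      have := hz (i + 1)
      rwa [pow_succ', show z * p 0 * (q * q ^ i) = z * q * p 0 * q ^ i by ring] at this
    obtain ⟨hAm, hAa⟩ := ih (z * q) (differentiable_dslope hφ 0) h1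
    obtain ⟨hBm, hBa⟩ := ih (z * q) (differentiable_dslope hp 0) h1
    have hl : AnalyticAt ℂ (fun w : ℂ => w * q) z := by fun_prop
    have hid : AnalyticAt ℂ (fun w : ℂ => w) z := analyticAt_id
    have hden : AnalyticAt ℂ (fun w : ℂ => 1 - w * p 0) z := by fun_prop
    have hev := eventually_mul_pow_ne_one hq1 (p 0) z
    constructor
    · have hA' := hAm.comp_analyticAt (g := fun w : ℂ => w * q) hl
      have hB' := hBm.comp_analyticAt (g := fun w : ℂ => w * q) hl
      have hc : MeromorphicAt (fun w => φ 0 / (1 - w * p 0)) z :=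
        (MeromorphicAt.const (φ 0) z).div hden.meromorphicAt
      refine (hc.add ((MeromorphicAt.const t z).mul
        (hA'.add ((hid.meromorphicAt.mul hc).mul hB')))).congr ?_
      filter_upwards [hev] with w hw
      exact (entireQSol_eq_dslope hq1 hp hφ hw t).symm
    · intro hzi
      have hA' := (hAa (h2 hzi)).comp_of_eq hl rfl
      have hB' := (hBa (h2 hzi)).comp_of_eq hl rfl
      have hc : AnalyticAt ℂ (fun w => φ 0 / (1 - w * p 0)) z :=
        analyticAt_const.div hden (sub_ne_zero.mpr (by simpa using (hzi 0).symm))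
      refine (hc.add ((analyticAt_const (v := t)).mul
        (hA'.add ((hid.mul hc).mul hB')))).congr ?_
      have : ∀ᶠ w in 𝓝 z, ∀ i : ℕ, w * p 0 * q ^ i ≠ 1 := by
        rw [eventually_nhdsWithin_iff] at hev
        filter_upwards [hev] with w hw
        by_cases h : w = z
        · rwa [h]
        · exact hw h
      filter_upwards [this] with w hw
      exact (entireQSol_eq_dslope hq1 hp hφ hw t).symm

theorem meromorphicAt_entireQSol {q : ℂ} (hq1 : ‖q‖ < 1) {p φ : ℂ → ℂ}
    (hp : Differentiable ℂ p) (hφ : Differentiable ℂ φ) (t z : ℂ) :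
    MeromorphicAt (fun w => entireQSol q p φ w t) z := by
  obtain ⟨N, hN⟩ := exists_pow_mul_lt_one hq1 (‖z‖ * ‖p 0‖)
  exact (meromorphicAt_and_analyticAt_entireQSol hq1 hp t N z hφ hN).1

theorem analyticAt_entireQSol {q : ℂ} (hq1 : ‖q‖ < 1) {p φ : ℂ → ℂ}
    (hp : Differentiable ℂ p) (hφ : Differentiable ℂ φ) (t : ℂ) {z : ℂ}
    (hz : ∀ i : ℕ, z * p 0 * q ^ i ≠ 1) :
    AnalyticAt ℂ (fun w => entireQSol q p φ w t) z := by
  obtain ⟨N, hN⟩ := exists_pow_mul_lt_one hq1 (‖z‖ * ‖p 0‖)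
  exact (meromorphicAt_and_analyticAt_entireQSol hq1 hp t N z hφ hN).2 hz

/-! ### Quasi-periodic entire functions -/

/-- At a simple zero $b$ of $g$ the quotient equals that of the difference quotients of $f$ and $g$
at $b$, whose denominator does not vanish there. -/
theorem exists_entire_quotient {f g : ℂ → ℂ} (hf : Differentiable ℂ f) (hg : Differentiable ℂ g)
    (h : ∀ b, g b = 0 → f b = 0 ∧ deriv g b ≠ 0) :
    ∃ v : ℂ → ℂ, Differentiable ℂ v ∧ ∀ t, f t = g t * v t := by
  classical
  refine ⟨fun t => if g t = 0 then deriv f t / deriv g t else f t / g t, fun b => ?_, fun t => ?_⟩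
  · by_cases hb : g b = 0
    · obtain ⟨hfb, hgb⟩ := h b hb
      have hF := (differentiable_dslope hf b).differentiableAt (x := b)
      have hG := (differentiable_dslope hg b).differentiableAt (x := b)
      have hG0 : dslope g b b ≠ 0 := by rwa [dslope_same]
      refine (hF.div hG hG0).congr_of_eventuallyEq ?_
      filter_upwards [hG.continuousAt.eventually_ne hG0] with t ht
      rcases eq_or_ne t b with rfl | htb
      · simp [hb, dslope_same]
      · have e1 := sub_smul_dslope f b t
        have e2 := sub_smul_dslope g b t
        rw [hfb, sub_zero, smul_eq_mul] at e1
        rw [hb, sub_zero, smul_eq_mul] at e2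
        have htb' := sub_ne_zero.mpr htb
        rw [if_neg (by rw [← e2]; exact mul_ne_zero htb' ht), ← e1, ← e2,
          mul_div_mul_left _ _ htb', Pi.div_apply]
    · refine ((hf b).div (hg b) hb).congr_of_eventuallyEq ?_
      filter_upwards [(hg b).continuousAt.eventually_ne hb] with t ht
      simp [ht]
  · by_cases ht : g t = 0
    · simp [ht, (h t ht).1]
    · simp only [if_neg ht]
      field_simp

theorem dense_ne_zero_of_deriv_ne_zero {g : ℂ → ℂ} (hg : Differentiable ℂ g)
    (h : ∀ b, g b = 0 → deriv g b ≠ 0) : Dense {t | g t ≠ 0} := by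
  intro b
  by_cases hb : g b = 0
  · rw [mem_closure_iff_frequently]
    have := (hg b).hasDerivAt.eventually_ne (h b hb) (c := 0)
    exact this.frequently.filter_mono nhdsWithin_le_nhds
  · exact subset_closure hb

-- A real exponent $a$ is chosen so that $\|e^{-a\tau}\|=\|C\|^{-1}$, while $\|e^{-2\pi ia}\|=1$
-- holds automatically. Then $\|e^{-at}F(t)\|$ is doubly periodic, hence bounded, and Liouville's
-- theorem applies.
open Complex in
theorem eq_mul_exp_of_quasiperiodic {q τ C : ℂ} (hq0 : q ≠ 0) (hq1 : ‖q‖ < 1) (hτ : exp τ = q)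
    (hC0 : C ≠ 0) {F : ℂ → ℂ} (hF : Differentiable ℂ F)
    (hper : ∀ t, F (t + 2 * Real.pi * I) = F t) (hqper : ∀ t, F (t + τ) = C * F t) (t : ℂ) :
    F t = F 0 * exp (((Real.log ‖C‖ / Real.log ‖q‖ : ℝ) : ℂ) * t) := by
  set a : ℝ := Real.log ‖C‖ / Real.log ‖q‖ with ha
  have hlq : Real.log ‖q‖ < 0 := Real.log_neg (norm_pos_iff.mpr hq0) hq1
  have hτre : τ.re = Real.log ‖q‖ := by
    rw [← hτ, norm_exp, Real.log_exp]
  let v : ℂ → ℂ := fun t => exp (-(a : ℂ) * t) * F t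
  have hv : Differentiable ℂ v := by dsimp only [v]; fun_prop
  have p1 : Function.Periodic (fun t => ‖v t‖) (2 * Real.pi * I) := fun t => by
    have h0 : ‖exp (-(a : ℂ) * (2 * Real.pi * I))‖ = 1 := by
      rw [norm_exp, Real.exp_eq_one_iff]
      simp
    simp only [v, norm_mul, hper, mul_add, exp_add, h0, mul_one]
  have p2 : Function.Periodic (fun t => ‖v t‖) τ := fun t => by
    have h0 : ‖exp (-(a : ℂ) * τ)‖ * ‖C‖ = 1 := by
      rw [norm_exp]
      have : (-(a : ℂ) * τ).re = -Real.log ‖C‖ := by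
        have : (-(a : ℂ) * τ).re = -(a * τ.re) := by simp
        rw [this, hτre, ha, div_mul_cancel₀ _ hlq.ne]
      rw [this, Real.exp_neg, Real.exp_log (norm_pos_iff.mpr hC0)]
      exact inv_mul_cancel₀ (norm_ne_zero_iff.mpr hC0)
    simp only [v, hqper, mul_add, exp_add, norm_mul]
    linear_combination ‖exp (-(a : ℂ) * t)‖ * ‖F t‖ * h0
  have hbdd : Bornology.IsBounded (Set.range v) := by
    obtain ⟨M, hM⟩ := (((isCompact_Icc (a := τ.re) (b := 0)).reProdIm
      (isCompact_Icc (a := 0) (b := 2 * Real.pi)))).exists_bound_of_continuousOn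
      hv.continuous.continuousOn
    refine isBounded_iff_forall_norm_le.mpr ⟨M, ?_⟩
    rintro _ ⟨t, rfl⟩
    have hτneg : 0 < -τ.re := by rw [hτre]; linarith
    -- A shift by a multiple of $\tau$ fixes the real part; the later shift by a multiple of $2\pi
    -- i$ fixes the imaginary part and leaves the real part alone.
    obtain ⟨k, hk⟩ : ∃ k : ℤ, (t - k • τ).re ∈ Set.Icc τ.re 0 := by
      refine ⟨⌊t.re / τ.re⌋, ?_⟩
      have h1 := Int.floor_le (t.re / τ.re)
      have h2 := (Int.lt_floor_add_one (t.re / τ.re)).le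
      rw [le_div_iff_of_neg (by linarith)] at h1
      rw [div_le_iff_of_neg (by linarith)] at h2
      have h3 : (t - ⌊t.re / τ.re⌋ • τ).re = t.re - ⌊t.re / τ.re⌋ * τ.re := by simp
      rw [h3]
      constructor <;> linarith
    obtain ⟨l, hl⟩ : ∃ l : ℤ, (t - k • τ - l • (2 * Real.pi * I)).im ∈ Set.Icc 0 (2 * Real.pi) := by
      set s := t - k • τ
      refine ⟨⌊s.im / (2 * Real.pi)⌋, ?_⟩
      have hpi := Real.two_pi_pos
      have h1 := Int.floor_le (s.im / (2 * Real.pi))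
      have h2 := (Int.lt_floor_add_one (s.im / (2 * Real.pi))).le
      rw [le_div_iff₀ hpi] at h1
      rw [div_le_iff₀ hpi] at h2
      have h3 : (s - ⌊s.im / (2 * Real.pi)⌋ • (2 * Real.pi * I)).im =
          s.im - ⌊s.im / (2 * Real.pi)⌋ * (2 * Real.pi) := by simp
      rw [h3]
      constructor <;> linarith
    have e : ‖v (t - k • τ - l • (2 * Real.pi * I))‖ = ‖v t‖ := by
      have e1 := p1.sub_zsmul_eq (x := t - k • τ) l
      have e2 := p2.sub_zsmul_eq (x := t) k
      exact e1.trans e2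
    rw [← e]
    refine hM _ ⟨?_, hl⟩
    have : (t - k • τ - l • (2 * Real.pi * I)).re = (t - k • τ).re := by simp
    rwa [Set.mem_preimage, this]
  have hconst := hv.apply_eq_apply_of_bounded hbdd t 0
  simp only [v, mul_zero, exp_zero, one_mul] at hconst
  rw [← hconst, mul_right_comm, ← exp_add]
  simp

-- If $F(0)\ne0$, then $F$ is a multiple of $e^{at}$; the period $2\pi i$ makes $a$ an integer, and
-- the shift by $\tau$ gives $C=q^a$.
open Complex in
theorem eq_zero_of_quasiperiodic {q τ C : ℂ} (hq0 : q ≠ 0) (hq1 : ‖q‖ < 1) (hτ : exp τ = q)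
    (hC0 : C ≠ 0) (hC : ∀ k : ℤ, C ≠ q ^ k) {F : ℂ → ℂ} (hF : Differentiable ℂ F)
    (hper : ∀ t, F (t + 2 * Real.pi * I) = F t) (hqper : ∀ t, F (t + τ) = C * F t) (t : ℂ) :
    F t = 0 := by
  have key := eq_mul_exp_of_quasiperiodic hq0 hq1 hτ hC0 hF hper hqper
  suffices h0 : F 0 = 0 by rw [key, h0, zero_mul]
  by_contra h0
  set a : ℝ := Real.log ‖C‖ / Real.log ‖q‖
  have h1 := hper 0
  rw [zero_add, key] at h1
  have h2 := hqper 0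
  rw [zero_add, key, mul_comm C] at h2
  have h1' : exp ((a : ℂ) * (2 * Real.pi * I)) = 1 := mul_left_cancel₀ h0 (by rw [h1, mul_one])
  have h2' := mul_left_cancel₀ h0 h2
  obtain ⟨k, hk⟩ := exp_eq_one_iff.mp h1'
  have hak : (a : ℂ) = k := mul_right_cancel₀ two_pi_I_ne_zero hk
  refine hC k ?_
  rw [← h2', hak, exp_int_mul, hτ]

-- Dividing by $\theta(e^t\alpha)$ removes the factor $-(e^t\alpha)^{-1}$ from the multiplier. The
-- relations for the quotient hold off the zeros of the theta factor, a dense set, and extend by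
-- continuity.
open Complex in
theorem exists_quotient_qJacobi {q τ α : ℂ} (hq0 : q ≠ 0) (hq1 : ‖q‖ < 1) (hτ : exp τ = q)
    (hα : α ≠ 0) {F K : ℂ → ℂ} (hF : Differentiable ℂ F) (hK : Continuous K)
    (hper : ∀ t, F (t + 2 * Real.pi * I) = F t)
    (hqper : ∀ t, F (t + τ) = K t * -(exp t * α)⁻¹ * F t)
    (hzero : ∀ (k : ℤ) (t : ℂ), exp t * α = q ^ k → F t = 0) :
    ∃ v : ℂ → ℂ, Differentiable ℂ v ∧ (∀ t, F t = qJacobi q (exp t * α) * v t) ∧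
      (∀ t, v (t + 2 * Real.pi * I) = v t) ∧ ∀ t, v (t + τ) = K t * v t := by
  have hne : ∀ t, exp t * α ≠ 0 := fun t => mul_ne_zero (exp_ne_zero t) hα
  let g : ℂ → ℂ := fun t => qJacobi q (exp t * α)
  have hgd : ∀ t, HasDerivAt g (deriv (qJacobi q) (exp t * α) * (exp t * α)) t := fun t =>
    HasDerivAt.comp (h₂ := qJacobi q) (h := fun t => exp t * α) t
      (differentiableAt_qJacobi hq1 (hne t)).hasDerivAt ((hasDerivAt_exp t).mul_const α)
  have hg : Differentiable ℂ g := fun t => (hgd t).differentiableAt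
  have hg0 : ∀ t, g t = 0 → ∃ k : ℤ, exp t * α = q ^ k := fun t ht => by
    by_contra! hcon
    exact qJacobi_ne_zero hq1 hq0 (hne t) hcon ht
  have hg1 : ∀ t, g t = 0 → deriv g t ≠ 0 := fun t ht => by
    obtain ⟨k, hk⟩ := hg0 t ht
    rw [(hgd t).deriv]
    refine mul_ne_zero ?_ (hne t)
    rw [hk]
    exact deriv_qJacobi_zpow_ne_zero hq1 hq0 k
  obtain ⟨v, hv, hFv⟩ := exists_entire_quotient hF hg fun t ht =>
    ⟨(hg0 t ht).elim fun k hk => hzero k t hk, hg1 t ht⟩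
  have hdense := dense_ne_zero_of_deriv_ne_zero hg hg1
  have hvc := hv.continuous
  refine ⟨v, hv, hFv, congrFun (Continuous.ext_on hdense (by fun_prop) hvc fun t ht => ?_),
    congrFun (Continuous.ext_on hdense (by fun_prop) (hK.mul hvc) fun t ht => ?_)⟩
  · have h := hper t
    have hgt : g (t + 2 * Real.pi * I) = g t := by
      simp only [g]
      rw [exp_add, exp_two_pi_mul_I, mul_one]
    rw [hFv, hFv, hgt] at h
    exact mul_left_cancel₀ ht h
  · have h := hqper t
    have hgt : g (t + τ) = -(exp t * α)⁻¹ * g t := by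
      simp only [g]
      rw [exp_add, hτ, ← qJacobi_mul_left hq1 hq0 (hne t)]
      ring_nf
    rw [hFv, hFv, hgt] at h
    refine mul_left_cancel₀ (mul_ne_zero (neg_ne_zero.mpr (inv_ne_zero (hne t))) ht) ?_
    rw [h]
    ring

-- Induction on the number of theta factors: after division by one of them the quotient still
-- vanishes at the zeros of the others, because the zero sets are disjoint. With none left, only the
-- constant $C$ remains.
open Complex in
theorem eq_zero_of_theta_quasiperiodic {q τ C : ℂ} (hq0 : q ≠ 0) (hq1 : ‖q‖ < 1)
    (hτ : exp τ = q) (hC0 : C ≠ 0) (hC : ∀ k : ℤ, C ≠ q ^ k) {ι : Type*} {α : ι → ℂ}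
    (hα0 : ∀ i, α i ≠ 0) (s : Finset ι)
    (hα : ∀ i ∈ s, ∀ j ∈ s, i ≠ j → ∀ k : ℤ, α i ≠ α j * q ^ k) :
    ∀ {F : ℂ → ℂ}, Differentiable ℂ F → (∀ t, F (t + 2 * Real.pi * I) = F t) →
    (∀ t, F (t + τ) = C * (∏ i ∈ s, -(exp t * α i)⁻¹) * F t) →
    (∀ i ∈ s, ∀ (k : ℤ) (t : ℂ), exp t * α i = q ^ k → F t = 0) → ∀ t, F t = 0 := by
  classical
  induction s using Finset.induction_on with
  | empty =>
    intro F hF hper hqper _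
    exact eq_zero_of_quasiperiodic hq0 hq1 hτ hC0 hC hF hper (by simpa using hqper)
  | insert a s has ih =>
    intro F hF hper hqper hzero
    have hK : Continuous fun t => C * ∏ i ∈ s, -(exp t * α i)⁻¹ := by
      refine continuous_const.mul (continuous_finsetProd _ fun i _ => ?_)
      exact (Continuous.inv₀ (by fun_prop) fun t => mul_ne_zero (exp_ne_zero t) (hα0 i)).neg
    obtain ⟨v, hv, hFv, hvper, hvq⟩ := exists_quotient_qJacobi hq0 hq1 hτ (hα0 a) hF hK hper
      (fun t => by rw [hqper, Finset.prod_insert has]; ring) (hzero a (Finset.mem_insert_self a s))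
    have hv0 := ih (fun i hi j hj => hα i (Finset.mem_insert_of_mem hi) j
      (Finset.mem_insert_of_mem hj)) hv hvper hvq fun i hi k t hik => by
        have h := hzero i (Finset.mem_insert_of_mem hi) k t hik
        rw [hFv] at h
        refine (mul_eq_zero.mp h).resolve_left ?_
        refine qJacobi_ne_zero hq1 hq0 (mul_ne_zero (exp_ne_zero t) (hα0 a)) fun l hl => ?_
        refine hα i (Finset.mem_insert_of_mem hi) a (Finset.mem_insert_self a s)
          (fun h => has (h ▸ hi)) (k - l) (mul_left_cancel₀ (exp_ne_zero t) ?_)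
        rw [← mul_assoc, hik, hl, zpow_sub₀ hq0]
        have := zpow_ne_zero l hq0
        field_simp
    intro t
    rw [hFv, hv0, mul_zero]

/-! ### The theta function -/

theorem qIterTerm_id (q t : ℂ) (d : ℕ) :
    qIterTerm q id (fun _ => 1) 1 t d = q ^ ((d : ℤ) * (d - 1) / 2) * t ^ d := by
  have h : ∀ d : ℕ, ∏ k ∈ Finset.range d, q ^ k * t = q ^ ((d : ℤ) * (d - 1) / 2) * t ^ d := by
    intro d
    rw [Finset.prod_mul_distrib, Finset.prod_pow_eq_pow_sum, Finset.prod_const, Finset.card_range,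
      Finset.sum_range_id, ← zpow_natCast]
    congr 2
    rcases d with _ | d
    · simp
    · push_cast; simp
  simp [qIterTerm, h]

/-- The nonnegative half of the theta series, `∑_{d ≥ 0} q^{d(d-1)/2} t^d`. -/
noncomputable def partialTheta (q : ℂ) : ℂ → ℂ := entireQSol q id (fun _ => 1) 1

theorem isEntireQSol_partialTheta {q : ℂ} (hq1 : ‖q‖ < 1) :
    IsEntireQSol q id (fun _ => 1) 1 (partialTheta q) :=
  isEntireQSol_entireQSol hq1 differentiable_id (differentiable_const 1) (by simp)

theorem partialTheta_eq {q : ℂ} (hq1 : ‖q‖ < 1) (t : ℂ) :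
    partialTheta q t = 1 + t * partialTheta q (q * t) := by
  simpa using (isEntireQSol_partialTheta hq1).eq t

theorem hasSum_partialTheta {q : ℂ} (hq1 : ‖q‖ < 1) (t : ℂ) :
    HasSum (fun d : ℕ => q ^ ((d : ℤ) * (d - 1) / 2) * t ^ d) (partialTheta q t) := by
  have := hasSum_entireQSol hq1 differentiable_id (differentiable_const (1 : ℂ)) (z := 1)
    (by simp) t
  exact (funext (qIterTerm_id q t)) ▸ this

/-- The negative indices form the same half series at $q/Q$; the term $d=0$ is counted twice. -/
theorem qTheta_eq_partialTheta {q : ℂ} (hq0 : q ≠ 0) (hq1 : ‖q‖ < 1) (Q : ℂ) :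
    qTheta q Q = partialTheta q Q + partialTheta q (q / Q) - 1 := by
  have h1 := hasSum_partialTheta hq1 Q
  have h2 := hasSum_partialTheta hq1 (q / Q)
  have h3 : ∀ d : ℕ, q ^ ((d : ℤ) * (d - 1) / 2) * (q / Q) ^ d =
      q ^ (-(d : ℤ) * (-d - 1) / 2) * Q ^ (-(d : ℤ)) := fun d => by
    have e : -(d : ℤ) * (-d - 1) / 2 = (d : ℤ) * (d - 1) / 2 + d := by
      rw [← Int.add_mul_ediv_right _ _ two_ne_zero]
      congr 1; ring
    rw [e, zpow_add₀ hq0, div_pow, zpow_neg, zpow_natCast, zpow_natCast, div_eq_mul_inv, mul_assoc]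
  have := HasSum.of_nat_of_neg (f := fun d : ℤ => q ^ (d * (d - 1) / 2) * Q ^ d)
    (by simpa only [zpow_natCast] using h1) ((funext h3) ▸ h2)
  simpa [qTheta] using this.tsum_eq

theorem qTheta_mul_left {q : ℂ} (hq0 : q ≠ 0) (hq1 : ‖q‖ < 1) {Q : ℂ} (hQ : Q ≠ 0) :
    qTheta q (q * Q) = Q⁻¹ * qTheta q Q := by
  rw [qTheta_eq_partialTheta hq0 hq1, qTheta_eq_partialTheta hq0 hq1, partialTheta_eq hq1 Q,
    partialTheta_eq hq1 (q / (q * Q))]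
  have : q * (q / (q * Q)) = q / Q := by field_simp
  rw [this]
  field_simp
  ring

theorem differentiableAt_qTheta {q : ℂ} (hq0 : q ≠ 0) (hq1 : ‖q‖ < 1) {Q : ℂ} (hQ : Q ≠ 0) :
    DifferentiableAt ℂ (qTheta q) Q := by
  have h := (isEntireQSol_partialTheta hq1).differentiable
  have e : qTheta q = fun Q => partialTheta q Q + partialTheta q (q / Q) - 1 :=
    funext (qTheta_eq_partialTheta hq0 hq1)
  rw [e]
  have h2 : DifferentiableAt ℂ (fun Q => partialTheta q (q / Q)) Q :=
    DifferentiableAt.comp (g := partialTheta q) (f := fun Q : ℂ => q / Q) Q (h _)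
      (by fun_prop (disch := assumption))
  fun_prop

/-- If $\theta_q$ vanished on $\mathbb C^*$, the entire half series would satisfy $T(t)=1-T(q/t)$,
hence be bounded and so constant. Its equation at $0$ and at $1$ would then give $1=2$. -/
theorem exists_qTheta_ne_zero {q : ℂ} (hq0 : q ≠ 0) (hq1 : ‖q‖ < 1) :
    ∃ Q ≠ 0, qTheta q Q ≠ 0 := by
  by_contra! hcon
  have hd := (isEntireQSol_partialTheta hq1).differentiable
  have he := partialTheta_eq hq1
  have hb : Bornology.IsBounded (Set.range (partialTheta q)) := by
    obtain ⟨M, hM⟩ := (isCompact_closedBall (0 : ℂ) 1).exists_bound_of_continuousOn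
      hd.continuous.continuousOn
    refine isBounded_iff_forall_norm_le.mpr ⟨max M (1 + M), ?_⟩
    rintro _ ⟨t, rfl⟩
    rcases le_total ‖t‖ 1 with ht | ht
    · exact (hM t (by simpa using ht)).trans (le_max_left _ _)
    · have ht0 : t ≠ 0 := norm_pos_iff.mp (by linarith)
      have h := hcon t ht0
      rw [qTheta_eq_partialTheta hq0 hq1] at h
      have e : partialTheta q t = 1 - partialTheta q (q / t) := by linear_combination h
      have hqt : ‖q / t‖ ≤ 1 := by
        rw [norm_div]
        exact div_le_one_of_le₀ (by linarith) (norm_nonneg _)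
      rw [e]
      refine ((norm_sub_le _ _).trans ?_).trans (le_max_right _ _)
      have := hM (q / t) (by simpa using hqt)
      simpa using this
  have hconst : ∀ t, partialTheta q t = partialTheta q 0 :=
    fun t => hd.apply_eq_apply_of_bounded hb t 0
  have h0 := he 0
  have h1 := he 1
  rw [hconst, hconst (q * 1)] at h1
  rw [zero_mul, add_zero] at h0
  norm_num [h0] at h1

theorem qTheta_neg_zpow {q : ℂ} (hq0 : q ≠ 0) (hq1 : ‖q‖ < 1) (k : ℤ) :
    qTheta q (-q ^ k) = 0 := by
  induction k using Int.induction_on with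
  | zero =>
    rw [qTheta_eq_partialTheta hq0 hq1, partialTheta_eq hq1 (-q ^ (0 : ℤ))]
    simp [div_neg]
  | succ k ih =>
    rw [zpow_add₀ hq0, zpow_one, mul_comm, ← mul_neg,
      qTheta_mul_left hq0 hq1 (neg_ne_zero.mpr (zpow_ne_zero _ hq0)), ih, mul_zero]
  | pred k ih =>
    have h := qTheta_mul_left hq0 hq1 (neg_ne_zero.mpr (zpow_ne_zero (-(k : ℤ) - 1) hq0))
    rw [mul_neg, ← zpow_one_add₀ hq0, add_sub_cancel, ih] at h
    exact (mul_eq_zero.mp h.symm).resolve_left (by simp [zpow_ne_zero _ hq0])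

-- The Jacobi triple product up to a constant: $\theta_q(-e^t)/\theta(e^t)$ is entire and doubly
-- periodic, hence constant. Only the nonvanishing of that constant matters, and
-- `exists_qTheta_ne_zero` provides it.
open Complex in
theorem qTheta_ne_zero {q : ℂ} (hq0 : q ≠ 0) (hq1 : ‖q‖ < 1) {Q : ℂ} (hQ0 : Q ≠ 0)
    (hQ : ∀ k : ℤ, Q ≠ -q ^ k) : qTheta q Q ≠ 0 := by
  have hτ := exp_log hq0
  have hne : ∀ t, -exp t ≠ 0 := fun t => neg_ne_zero.mpr (exp_ne_zero t)
  obtain ⟨v, hv, hFv, hvper, hvq⟩ := exists_quotient_qJacobi (α := 1) (K := fun _ => 1)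
    (F := fun t => qTheta q (-exp t)) hq0 hq1 hτ one_ne_zero
    (fun t => DifferentiableAt.comp (g := qTheta q) (f := fun t => -exp t) t
      (differentiableAt_qTheta hq0 hq1 (hne t)) (by fun_prop)) continuous_const
    (fun t => by rw [exp_add, exp_two_pi_mul_I, mul_one])
    (fun t => by
      rw [exp_add, hτ, mul_comm, ← mul_neg, qTheta_mul_left hq0 hq1 (hne t), inv_neg, mul_one,
        one_mul])
    (fun k t h => by rw [mul_one] at h; rw [h, qTheta_neg_zpow hq0 hq1])
  have hconst := eq_mul_exp_of_quasiperiodic hq0 hq1 hτ one_ne_zero hv hvper hvq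
  simp only [norm_one, Real.log_one, zero_div, ofReal_zero, zero_mul, exp_zero, mul_one] at hconst
  have key : ∀ Q ≠ 0, qTheta q Q = qJacobi q (-Q) * v 0 := fun Q hQ => by
    have := hFv (log (-Q))
    rwa [exp_log (neg_ne_zero.mpr hQ), neg_neg, mul_one, hconst] at this
  obtain ⟨Q', hQ'0, hQ'⟩ := exists_qTheta_ne_zero hq0 hq1
  rw [key Q' hQ'0] at hQ'
  rw [key Q hQ0]
  exact mul_ne_zero (qJacobi_ne_zero hq1 hq0 (neg_ne_zero.mpr hQ0)
    fun k hk => hQ k (neg_eq_iff_eq_neg.mp hk)) (right_ne_zero_of_mul hQ')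

/-! ### The continued Frobenius series -/

/-- `φ(t) = ∏_i (q t / α_i; q)_∞`. -/
noncomputable def frobPhi {m : ℕ} (q : ℂ) (α : Fin m → ℂ) (t : ℂ) : ℂ :=
  ∏ i, qPochInf q (q * t / α i)

/-- `p(t) = (-q t)^{m - n} (1 - t)^n`. -/
def frobPoly (n m : ℕ) (q t : ℂ) : ℂ := (-(q * t)) ^ (m - n) * (1 - t) ^ n

theorem differentiable_frobPhi {m : ℕ} {q : ℂ} (hq1 : ‖q‖ < 1) (α : Fin m → ℂ) :
    Differentiable ℂ (frobPhi q α) := by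
  have h := differentiable_qPochInf hq1
  unfold frobPhi
  fun_prop

theorem differentiable_frobPoly (n m : ℕ) (q : ℂ) : Differentiable ℂ (frobPoly n m q) := by
  unfold frobPoly
  fun_prop

theorem frobPhi_eq_mul {m : ℕ} {q : ℂ} (hq1 : ‖q‖ < 1) (α : Fin m → ℂ) (t : ℂ) :
    frobPhi q α t = (∏ i, (1 - q * t / α i)) * frobPhi q α (q * t) := by
  rw [frobPhi, frobPhi, ← Finset.prod_mul_distrib]
  refine Finset.prod_congr rfl fun i _ => ?_
  rw [qPochInf_eq_mul hq1]
  ring_nf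

theorem frobPhi_ne_zero {m : ℕ} {q : ℂ} (hq1 : ‖q‖ < 1) {α : Fin m → ℂ}
    (hα0 : ∀ j, α j ≠ 0) (hαres : ∀ i j, ∀ k : ℤ, k ≠ 0 → α i ≠ α j * q ^ k) (j : Fin m) :
    frobPhi q α (α j) ≠ 0 := by
  refine Finset.prod_ne_zero_iff.mpr fun i _ => qPochInf_ne_zero hq1 fun k h => ?_
  refine hαres i j (k + 1 : ℕ) (by positivity) ?_
  have := hα0 i
  field_simp at h
  rw [← h, zpow_natCast, pow_succ]
  ring

theorem frobeniusCoeff_succ (n : ℕ) {m : ℕ} (q : ℂ) (α : Fin m → ℂ) (j : Fin m) (d : ℕ) :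
    frobeniusCoeff n q α j (d + 1) = frobeniusCoeff n q α j d *
      ((1 - (α j)⁻¹ * (q ^ d)⁻¹) ^ n / ∏ i, (1 - α i / α j * (q ^ (d + 1))⁻¹)) := by
  simp only [frobeniusCoeff, Finset.prod_range_succ, Finset.prod_Icc_succ_top (Nat.le_add_left 1 d),
    Finset.prod_mul_distrib]
  rw [mul_div_mul_comm]

/-- Both sides agree at $d=0$ and have the same ratio of consecutive terms. Pulling
$-q^{d+1}\alpha_j/\alpha_i$ out of $1-q^{d+1}\alpha_j/\alpha_i$, and $-q^d\alpha_j$ out of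
$1-q^d\alpha_j$, turns $q$ into $q^{-1}$; the choice $z=wq^n/\prod_i\alpha_i$ and the factor
$(-qt)^{m-n}$ absorb the monomials that appear. -/
theorem qIterTerm_frob {n m : ℕ} (hmn : n ≤ m) {q : ℂ} (hq0 : q ≠ 0) (hq1 : ‖q‖ < 1)
    {α : Fin m → ℂ} (hα0 : ∀ j, α j ≠ 0) (hαres : ∀ i j, ∀ k : ℤ, k ≠ 0 → α i ≠ α j * q ^ k)
    (j : Fin m) (w : ℂ) (d : ℕ) :
    qIterTerm q (frobPoly n m q) (frobPhi q α) (w * q ^ n / ∏ i, α i) (α j) d =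
      frobPhi q α (α j) * (frobeniusCoeff n q α j d * w ^ d) := by
  induction d with
  | zero => simp [qIterTerm, frobeniusCoeff]
  | succ d ih =>
    have hj := hα0 j
    have hA : ∏ i, α i ≠ 0 := Finset.prod_ne_zero_iff.mpr fun i _ => hα0 i
    set z := w * q ^ n / ∏ i, α i with hz
    have hqd : ∀ d : ℕ, q ^ d ≠ 0 := fun d => pow_ne_zero d hq0
    have hden : ∀ i, 1 - α i / α j * (q ^ (d + 1))⁻¹ ≠ 0 := fun i h => by
      refine hαres i j (d + 1 : ℕ) (by positivity) ?_
      have := hqd (d + 1)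
      rw [sub_eq_zero] at h
      field_simp at h
      rw [zpow_natCast, h]
    have hnum : ∀ i, 1 - q * (q ^ d * α j) / α i =
        -(q ^ (d + 1) * α j) / α i * (1 - α i / α j * (q ^ (d + 1))⁻¹) := fun i => by
      have := hqd (d + 1)
      have := hα0 i
      field_simp
      ring
    have hprod : ∏ i, (1 - q * (q ^ d * α j) / α i) =
        (-(q ^ (d + 1) * α j)) ^ m / (∏ i, α i) * ∏ i, (1 - α i / α j * (q ^ (d + 1))⁻¹) := by
      simp only [hnum, Finset.prod_mul_distrib, Finset.prod_div_distrib, Finset.prod_const,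
        Finset.card_univ, Fintype.card_fin]
    have hD : ∏ i, (1 - α i / α j * (q ^ (d + 1))⁻¹) ≠ 0 :=
      Finset.prod_ne_zero_iff.mpr fun i _ => hden i
    have hN : ∏ i, (1 - q * (q ^ d * α j) / α i) ≠ 0 := by
      rw [hprod]
      exact mul_ne_zero (div_ne_zero (pow_ne_zero _ (neg_ne_zero.mpr
        (mul_ne_zero (hqd _) hj))) hA) hD
    have hp : z * frobPoly n m q (q ^ d * α j) =
        w * (1 - (α j)⁻¹ * (q ^ d)⁻¹) ^ n * ((-(q ^ (d + 1) * α j)) ^ m / ∏ i, α i) := by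
      have e1 : 1 - q ^ d * α j = -(q ^ d * α j) * (1 - (α j)⁻¹ * (q ^ d)⁻¹) := by
        have := hqd d
        field_simp
        ring
      have e2 : (-(q ^ (d + 1) * α j)) ^ m =
          (-(q ^ (d + 1) * α j)) ^ (m - n) * (-(q ^ (d + 1) * α j)) ^ n := by
        rw [← pow_add, Nat.sub_add_cancel hmn]
      have e3 : -(q ^ (d + 1) * α j) = q * -(q ^ d * α j) := by ring
      rw [hz, frobPoly, e1, e2, mul_pow, e3, mul_pow q _ n, ← mul_neg]
      ring
    refine mul_left_cancel₀ hN ?_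
    have ih' : z ^ d * ((∏ k ∈ Finset.range d, frobPoly n m q (q ^ k * α j)) *
        frobPhi q α (q ^ d * α j)) = frobPhi q α (α j) * (frobeniusCoeff n q α j d * w ^ d) := ih
    rw [frobPhi_eq_mul hq1] at ih'
    have hstep : (∏ i, (1 - q * (q ^ d * α j) / α i)) * qIterTerm q (frobPoly n m q) (frobPhi q α)
        z (α j) (d + 1) = z * frobPoly n m q (q ^ d * α j) *
          (frobPhi q α (α j) * (frobeniusCoeff n q α j d * w ^ d)) := by
      rw [← ih', qIterTerm, Finset.prod_range_succ, pow_succ' q, mul_assoc q]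
      ring
    rw [hstep, hp, frobeniusCoeff_succ, hprod]
    set P := ∏ i, (1 - α i / α j * (q ^ (d + 1))⁻¹)
    set x := (1 - (α j)⁻¹ * (q ^ d)⁻¹) ^ n
    set y := (-(q ^ (d + 1) * α j)) ^ m
    field_simp
    ring

/-- The meromorphic continuation of the power series with coefficients `frobeniusCoeff n q α j`. -/
noncomputable def frobeniusFactor (n : ℕ) {m : ℕ} (q : ℂ) (α : Fin m → ℂ) (j : Fin m) (w : ℂ) : ℂ :=
  entireQSol q (frobPoly n m q) (frobPhi q α) (w * q ^ n / ∏ i, α i) (α j) / frobPhi q α (α j)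

theorem frobPoly_zero (n m : ℕ) (q : ℂ) : frobPoly n m q 0 = 0 ^ (m - n) := by
  simp [frobPoly]

/-- For $m>n$ one has $p(0)=0$ and nothing is resonant; for $m=n$ one has $p(0)=1$, and the
resonances are exactly the excluded points. -/
theorem frob_mul_pow_ne_one {n m : ℕ} (hmn : n ≤ m) {q : ℂ} {α : Fin m → ℂ} (hα0 : ∀ j, α j ≠ 0)
    {w : ℂ} (hw : m = n → ∀ k : ℕ, w * q ^ (n + k) ≠ ∏ i, α i) (k : ℕ) :
    w * q ^ n / (∏ i, α i) * frobPoly n m q 0 * q ^ k ≠ 1 := by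
  have hA : ∏ i, α i ≠ 0 := Finset.prod_ne_zero_iff.mpr fun i _ => hα0 i
  rw [frobPoly_zero]
  rcases hmn.eq_or_lt with h | h
  · intro hk
    refine hw h.symm k ?_
    rw [h, Nat.sub_self, pow_zero, mul_one] at hk
    field_simp at hk
    rw [← hk, pow_add, h]
    ring
  · rw [zero_pow (by omega)]
    simp

theorem isFrobeniusFactor_frobeniusFactor {n m : ℕ} (hmn : n ≤ m) {q : ℂ} (hq0 : q ≠ 0)
    (hq1 : ‖q‖ < 1) {α : Fin m → ℂ} (hα0 : ∀ j, α j ≠ 0)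
    (hαres : ∀ i j, ∀ k : ℤ, k ≠ 0 → α i ≠ α j * q ^ k) (j : Fin m) :
    IsFrobeniusFactor n q α j (frobeniusFactor n q α j) := by
  have hA : ∏ i, α i ≠ 0 := Finset.prod_ne_zero_iff.mpr fun i _ => hα0 i
  have hφ0 := frobPhi_ne_zero hq1 hα0 hαres j
  have hp := differentiable_frobPoly n m q
  have hφ := differentiable_frobPhi hq1 α
  have hl : ∀ w, AnalyticAt ℂ (fun w : ℂ => w * q ^ n / ∏ i, α i) w := fun w => by
    fun_prop (disch := assumption)
  refine ⟨fun w hw => ?_, fun w => ?_, fun w hw => ?_⟩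
  · have hz : ‖w * q ^ n / ∏ i, α i‖ * ‖frobPoly n m q 0‖ < 1 := by
      rw [frobPoly_zero]
      rcases hmn.eq_or_lt with h | h
      · rw [Nat.sub_eq_zero_of_le h.ge, pow_zero, norm_one, mul_one, norm_div, norm_mul, norm_pow,
          div_lt_one (norm_pos_iff.mpr hA)]
        exact hw.resolve_left (by omega)
      · rw [zero_pow (by omega), norm_zero, mul_zero]
        exact one_pos
    have := (hasSum_entireQSol hq1 hp hφ hz (α j)).div_const (frobPhi q α (α j))
    refine (funext fun d => ?_ : _ = fun d : ℕ => frobeniusCoeff n q α j d * w ^ d) ▸ this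
    rw [qIterTerm_frob hmn hq0 hq1 hα0 hαres, mul_div_cancel_left₀ _ hφ0]
  · exact ((meromorphicAt_entireQSol hq1 hp hφ (α j) _).comp_analyticAt (hl w)).div
      (MeromorphicAt.const _ w)
  · exact ((analyticAt_entireQSol hq1 hp hφ (α j) (frob_mul_pow_ne_one hmn hα0 hw)).comp_of_eq
      (hl w) rfl).div analyticAt_const hφ0

/-- Both functions equal the power series near $0$, and the complement of the countable set of
possible poles is connected, so the identity theorem applies. -/
theorem IsFrobeniusFactor.eq {n m : ℕ} {q : ℂ} (hq0 : q ≠ 0) {α : Fin m → ℂ}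
    (hα0 : ∀ j, α j ≠ 0) {j : Fin m} {G₁ G₂ : ℂ → ℂ} (h₁ : IsFrobeniusFactor n q α j G₁)
    (h₂ : IsFrobeniusFactor n q α j G₂) {w : ℂ}
    (hw : m = n → ∀ k : ℕ, w * q ^ (n + k) ≠ ∏ i, α i) : G₁ w = G₂ w := by
  have hA : ∏ i, α i ≠ 0 := Finset.prod_ne_zero_iff.mpr fun i _ => hα0 i
  let S : Set ℂ := Set.range fun k : ℕ => (∏ i, α i) / q ^ (n + k)
  have hS : S.Countable := Set.countable_range _
  let U : Set ℂ := {w | m = n → ∀ k : ℕ, w * q ^ (n + k) ≠ ∏ i, α i}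
  have hU : IsPreconnected U := by
    by_cases hmn' : m = n
    · have : U = Sᶜ := by
        ext w
        simp only [U, S, hmn', forall_const, Set.mem_ofPred_eq, Set.mem_compl_iff, Set.mem_range,
          not_exists]
        refine forall_congr' fun k => not_congr ?_
        rw [div_eq_iff (pow_ne_zero _ hq0), eq_comm]
      rw [this]
      refine (hS.isPathConnected_compl_of_one_lt_rank ?_).isConnected.isPreconnected
      rw [Complex.rank_real_complex]
      exact Cardinal.one_lt_two
    · have : U = Set.univ := by
        ext w; simp [U, hmn']
      rw [this]
      exact isPreconnected_univ
  have h0 : (0 : ℂ) ∈ U := fun _ k => by rw [zero_mul]; exact hA.symm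
  refine AnalyticOnNhd.eqOn_of_preconnected_of_eventuallyEq (fun w hw => h₁.analyticAt w hw)
    (fun w hw => h₂.analyticAt w hw) hU h0 ?_ hw
  have hc : Continuous fun w : ℂ => ‖w‖ * ‖q‖ ^ n := by fun_prop
  have hA' : ‖(0 : ℂ)‖ * ‖q‖ ^ n < ‖∏ i, α i‖ := by
    rw [norm_zero, zero_mul]
    exact norm_pos_iff.mpr hA
  filter_upwards [hc.continuousAt.eventually (gt_mem_nhds hA')] with w hw
  exact (h₁.hasSum w (.inr hw)).unique (h₂.hasSum w (.inr hw))

/-! ### The connection formula for a generic argument -/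

/-- The numerator `∏_i (1 - x α_i)` of the recursion of the series at `Q = 0`. -/
def seriesPoly {m : ℕ} (α : Fin m → ℂ) (x : ℂ) : ℂ := ∏ i, (1 - x * α i)

/-- `ψ(x) = (q x; q)_∞^n`. -/
noncomputable def seriesPsi (n : ℕ) (q x : ℂ) : ℂ := qPochInf q (q * x) ^ n

theorem differentiable_seriesPoly {m : ℕ} (α : Fin m → ℂ) : Differentiable ℂ (seriesPoly α) := by
  unfold seriesPoly
  fun_prop

theorem differentiable_seriesPsi {q : ℂ} (hq1 : ‖q‖ < 1) (n : ℕ) :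
    Differentiable ℂ (seriesPsi n q) := by
  have := differentiable_qPochInf hq1
  unfold seriesPsi
  fun_prop

theorem seriesPoly_zero {m : ℕ} (α : Fin m → ℂ) : seriesPoly α 0 = 1 := by
  simp [seriesPoly]

/-- The bilateral sum `∑_{d ∈ ℤ} ∏_i θ(x α_i) (x q^{d+1}; q)_∞^n / ∏_i (x α_i q^d; q)_∞ Q^d`,
continued in `Q`. -/
noncomputable def bilateralSum (n : ℕ) {m : ℕ} (q : ℂ) (α : Fin m → ℂ) (Q x : ℂ) : ℂ :=
  frobPhi q α x⁻¹ * entireQSol q (seriesPoly α) (seriesPsi n q) Q x +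
    seriesPsi n q x * (entireQSol q (frobPoly n m q) (frobPhi q α)
      (Q⁻¹ * q ^ n / ∏ i, α i) x⁻¹ - frobPhi q α x⁻¹)

theorem bilateralSum_mul_left {n m : ℕ} (hmn : n ≤ m) {q : ℂ} (hq0 : q ≠ 0) (hq1 : ‖q‖ < 1)
    {α : Fin m → ℂ} (hα0 : ∀ j, α j ≠ 0) {Q : ℂ} (hQ0 : Q ≠ 0) (hQ1 : ‖Q‖ < 1)
    (hQ : m = n → ∀ k : ℕ, Q⁻¹ * q ^ (n + k) ≠ ∏ i, α i) {x : ℂ} (hx : x ≠ 0) :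
    bilateralSum n q α Q (q * x) = Q⁻¹ * (∏ i, -(x * α i)⁻¹) * bilateralSum n q α Q x := by
  have hA : ∏ i, α i ≠ 0 := Finset.prod_ne_zero_iff.mpr fun i _ => hα0 i
  have hB := (isEntireQSol_entireQSol hq1 (differentiable_seriesPoly α)
    (differentiable_seriesPsi hq1 n) (z := Q)
    (mul_pow_ne_one hq1 (by simpa [seriesPoly_zero] using hQ1))).eq x
  have hT := (isEntireQSol_entireQSol hq1 (differentiable_frobPoly n m q)
    (differentiable_frobPhi hq1 α) (frob_mul_pow_ne_one hmn hα0 hQ)).eq (q * x)⁻¹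
  have hqx : q * (q * x)⁻¹ = x⁻¹ := by field_simp
  have hφ := frobPhi_eq_mul hq1 α (q * x)⁻¹
  rw [hqx] at hT hφ
  have hφ' : ∏ i, (1 - x⁻¹ / α i) = (∏ i, -(x * α i)⁻¹) * seriesPoly α x := by
    rw [seriesPoly, ← Finset.prod_mul_distrib]
    refine Finset.prod_congr rfl fun i _ => ?_
    have := hα0 i
    field_simp
    ring
  rw [hφ'] at hφ
  have hψ : seriesPsi n q x = (1 - q * x) ^ n * seriesPsi n q (q * x) := by
    rw [seriesPsi, seriesPsi, ← mul_pow, ← qPochInf_eq_mul hq1]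
  have hp : Q⁻¹ * q ^ n / (∏ i, α i) * frobPoly n m q (q * x)⁻¹ =
      Q⁻¹ * (∏ i, -(x * α i)⁻¹) * (1 - q * x) ^ n := by
    have e1 : ∏ i, -(x * α i)⁻¹ = (-x⁻¹) ^ m * (∏ i, α i)⁻¹ := by
      simp only [mul_inv, ← neg_mul, Finset.prod_mul_distrib, Finset.prod_const, Finset.card_univ,
        Fintype.card_fin, Finset.prod_inv_distrib]
    have e2 : 1 - (q * x)⁻¹ = -x⁻¹ * q⁻¹ * (1 - q * x) := by
      field_simp
      ring
    have e3 : (-x⁻¹) ^ m = (-x⁻¹) ^ (m - n) * (-x⁻¹) ^ n := by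
      rw [← pow_add, Nat.sub_add_cancel hmn]
    rw [frobPoly, hqx, e1, e2, e3, mul_pow, mul_pow, inv_pow]
    field_simp
  rw [hp] at hT
  unfold bilateralSum
  rw [hT, hφ, hB, hψ]
  field_simp
  ring

/-- At $x=\alpha_j^{-1}$ the factor $1-x\alpha_j$ truncates the half with $d\ge0$ to its first term,
which cancels the subtracted term of the other half. -/
theorem bilateralSum_inv {n m : ℕ} {q : ℂ} (hq1 : ‖q‖ < 1) {α : Fin m → ℂ} {Q : ℂ}
    (hQ1 : ‖Q‖ < 1) {j : Fin m} (hα : α j ≠ 0) : bilateralSum n q α Q (α j)⁻¹ =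
      seriesPsi n q (α j)⁻¹ * entireQSol q (frobPoly n m q) (frobPhi q α)
        (Q⁻¹ * q ^ n / ∏ i, α i) (α j) := by
  have hB := (isEntireQSol_entireQSol hq1 (differentiable_seriesPoly α)
    (differentiable_seriesPsi hq1 n) (z := Q)
    (mul_pow_ne_one hq1 (by simpa [seriesPoly_zero] using hQ1))).eq (α j)⁻¹
  have h0 : seriesPoly α (α j)⁻¹ = 0 :=
    Finset.prod_eq_zero (Finset.mem_univ j) (by rw [inv_mul_cancel₀ hα, sub_self])
  rw [bilateralSum, hB, h0, inv_inv]
  ring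

/-- The coefficients of the expansion of `bilateralSum` in products of theta functions. -/
noncomputable def thetaCoeff (n : ℕ) {m : ℕ} (q : ℂ) (α : Fin m → ℂ) (Q : ℂ) (j : Fin m) : ℂ :=
  seriesPsi n q (α j)⁻¹ * entireQSol q (frobPoly n m q) (frobPhi q α)
    (Q⁻¹ * q ^ n / ∏ i, α i) (α j) /
      (qJacobi q Q * ∏ i ∈ Finset.univ.erase j, qJacobi q (α i / α j))

/-- The expansion of `bilateralSum` in products of theta functions. -/
noncomputable def thetaSum (n : ℕ) {m : ℕ} (q : ℂ) (α : Fin m → ℂ) (Q x : ℂ) : ℂ :=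
  ∑ j, thetaCoeff n q α Q j *
    (qJacobi q (x * α j * Q) * ∏ i ∈ Finset.univ.erase j, qJacobi q (x * α i))

theorem thetaSum_mul_left (n : ℕ) {m : ℕ} {q : ℂ} (hq0 : q ≠ 0) (hq1 : ‖q‖ < 1)
    {α : Fin m → ℂ} (hα0 : ∀ j, α j ≠ 0) {Q : ℂ} (hQ0 : Q ≠ 0) {x : ℂ} (hx : x ≠ 0) :
    thetaSum n q α Q (q * x) = Q⁻¹ * (∏ i, -(x * α i)⁻¹) * thetaSum n q α Q x := by
  rw [thetaSum, thetaSum, Finset.mul_sum]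
  refine Finset.sum_congr rfl fun j _ => ?_
  have h1 : ∏ i ∈ Finset.univ.erase j, qJacobi q (q * x * α i) =
      (∏ i ∈ Finset.univ.erase j, -(x * α i)⁻¹) *
        ∏ i ∈ Finset.univ.erase j, qJacobi q (x * α i) := by
    rw [← Finset.prod_mul_distrib]
    refine Finset.prod_congr rfl fun i _ => ?_
    rw [mul_assoc, qJacobi_mul_left hq1 hq0 (mul_ne_zero hx (hα0 i))]
  have h2 : qJacobi q (q * x * α j * Q) = -(x * α j)⁻¹ * Q⁻¹ * qJacobi q (x * α j * Q) := by
    rw [show q * x * α j * Q = q * (x * α j * Q) by ring,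
      qJacobi_mul_left hq1 hq0 (mul_ne_zero (mul_ne_zero hx (hα0 j)) hQ0), mul_inv _ Q]
    ring
  rw [h1, h2, ← Finset.mul_prod_erase _ _ (Finset.mem_univ j)]
  ring

/-- Lagrange interpolation: every summand other than the $j$-th contains $\theta(1)=0$. -/
theorem thetaSum_inv (n : ℕ) {m : ℕ} {q : ℂ} (hq0 : q ≠ 0) (hq1 : ‖q‖ < 1)
    {α : Fin m → ℂ} (hα0 : ∀ j, α j ≠ 0)
    (hα : ∀ i j, i ≠ j → ∀ k : ℤ, α i ≠ α j * q ^ k) {Q : ℂ} (hQ0 : Q ≠ 0)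
    (hQ : ∀ k : ℤ, Q ≠ q ^ k) (j : Fin m) : thetaSum n q α Q (α j)⁻¹ =
      seriesPsi n q (α j)⁻¹ * entireQSol q (frobPoly n m q) (frobPhi q α)
        (Q⁻¹ * q ^ n / ∏ i, α i) (α j) := by
  have hj := hα0 j
  rw [thetaSum, Finset.sum_eq_single j]
  · rw [thetaCoeff, inv_mul_cancel₀ hj, one_mul]
    have h1 : ∀ i, (α j)⁻¹ * α i = α i / α j := fun i => by rw [mul_comm, div_eq_mul_inv]
    simp only [h1]
    refine div_mul_cancel₀ _ (mul_ne_zero (qJacobi_ne_zero hq1 hq0 hQ0 hQ)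
      (Finset.prod_ne_zero_iff.mpr fun i hi => qJacobi_ne_zero hq1 hq0
        (div_ne_zero (hα0 i) hj) fun k hk => ?_))
    refine hα i j (Finset.ne_of_mem_erase hi) k ?_
    rw [← hk]
    field_simp
  · intro l _ hl
    have : ∏ i ∈ Finset.univ.erase l, qJacobi q ((α j)⁻¹ * α i) = 0 := by
      refine Finset.prod_eq_zero (Finset.mem_erase.mpr ⟨hl.symm, Finset.mem_univ j⟩) ?_
      rw [inv_mul_cancel₀ hj]
      simpa using qJacobi_zpow hq1 hq0 0
    rw [this, mul_zero, mul_zero]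
  · simp

theorem differentiableAt_bilateralSum {n m : ℕ} (hmn : n ≤ m) {q : ℂ} (hq1 : ‖q‖ < 1)
    {α : Fin m → ℂ} (hα0 : ∀ j, α j ≠ 0) {Q : ℂ} (hQ1 : ‖Q‖ < 1)
    (hQ : m = n → ∀ k : ℕ, Q⁻¹ * q ^ (n + k) ≠ ∏ i, α i) {x : ℂ} (hx : x ≠ 0) :
    DifferentiableAt ℂ (bilateralSum n q α Q) x := by
  have hψ := differentiable_seriesPsi hq1 n
  have hφ := differentiable_frobPhi hq1 α
  have hB := (isEntireQSol_entireQSol hq1 (differentiable_seriesPoly α) hψ (z := Q)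
    (mul_pow_ne_one hq1 (by simpa [seriesPoly_zero] using hQ1))).differentiable
  have hT := (isEntireQSol_entireQSol hq1 (differentiable_frobPoly n m q) hφ
    (frob_mul_pow_ne_one hmn hα0 hQ)).differentiable
  have hinv : DifferentiableAt ℂ (fun x : ℂ => x⁻¹) x := differentiableAt_inv hx
  have h1 := (hφ x⁻¹).comp x hinv
  have h2 := (hT x⁻¹).comp x hinv
  exact (h1.mul (hB x)).add ((hψ x).mul (h2.sub h1))

theorem differentiableAt_thetaSum (n : ℕ) {m : ℕ} {q : ℂ} (hq1 : ‖q‖ < 1)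
    {α : Fin m → ℂ} (hα0 : ∀ j, α j ≠ 0) {Q : ℂ} (hQ0 : Q ≠ 0) {x : ℂ} (hx : x ≠ 0) :
    DifferentiableAt ℂ (thetaSum n q α Q) x := by
  have h : ∀ a : ℂ, a ≠ 0 → DifferentiableAt ℂ (fun x => qJacobi q (x * a)) x := fun a ha =>
    DifferentiableAt.comp (g := qJacobi q) (f := fun x => x * a) x
      (differentiableAt_qJacobi hq1 (mul_ne_zero hx ha)) (by fun_prop)
  unfold thetaSum
  refine DifferentiableAt.fun_sum fun j _ => ?_
  refine (DifferentiableAt.mul ?_ (DifferentiableAt.fun_finsetProd fun i _ => h _ (hα0 i))).const_mul _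
  simpa only [mul_assoc] using h _ (mul_ne_zero (hα0 j) hQ0)

open Complex in
/-- The connection formula for a generic argument. -/
theorem bilateralSum_eq_thetaSum {n m : ℕ} (hmn : n ≤ m) {q : ℂ} (hq0 : q ≠ 0) (hq1 : ‖q‖ < 1)
    {α : Fin m → ℂ} (hα0 : ∀ j, α j ≠ 0)
    (hα : ∀ i j, i ≠ j → ∀ k : ℤ, α i ≠ α j * q ^ k) {Q : ℂ} (hQ0 : Q ≠ 0) (hQ1 : ‖Q‖ < 1)
    (hQ : ∀ k : ℤ, Q ≠ q ^ k) (hQm : m = n → ∀ k : ℕ, Q⁻¹ * q ^ (n + k) ≠ ∏ i, α i)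
    {x : ℂ} (hx : x ≠ 0) : bilateralSum n q α Q x = thetaSum n q α Q x := by
  let Y : ℂ → ℂ := fun x => bilateralSum n q α Q x - thetaSum n q α Q x
  have hYd : ∀ x ≠ 0, DifferentiableAt ℂ Y x := fun x hx =>
    (differentiableAt_bilateralSum hmn hq1 hα0 hQ1 hQm hx).sub
      (differentiableAt_thetaSum n hq1 hα0 hQ0 hx)
  have hYq : ∀ x ≠ 0, Y (q * x) = Q⁻¹ * (∏ i, -(x * α i)⁻¹) * Y x := fun x hx => by
    simp only [Y]
    rw [bilateralSum_mul_left hmn hq0 hq1 hα0 hQ0 hQ1 hQm hx,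
      thetaSum_mul_left n hq0 hq1 hα0 hQ0 hx, mul_sub]
  have hY0 : ∀ j, ∀ k : ℤ, Y (q ^ k * (α j)⁻¹) = 0 := fun j k => by
    have hj := inv_ne_zero (hα0 j)
    induction k using Int.induction_on with
    | zero =>
      simp only [Y, zpow_zero, one_mul]
      rw [bilateralSum_inv hq1 hQ1 (hα0 j), thetaSum_inv n hq0 hq1 hα0 hα hQ0 hQ, sub_self]
    | succ k ih =>
      rw [zpow_add₀ hq0, zpow_one, mul_comm _ q, mul_assoc,
        hYq _ (mul_ne_zero (zpow_ne_zero _ hq0) hj), ih, mul_zero]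
    | pred k ih =>
      have hne : q ^ (-(k : ℤ) - 1) * (α j)⁻¹ ≠ 0 := mul_ne_zero (zpow_ne_zero _ hq0) hj
      have h := hYq _ hne
      rw [← mul_assoc, ← zpow_one_add₀ hq0, add_sub_cancel, ih] at h
      refine (mul_eq_zero.mp h.symm).resolve_left (mul_ne_zero (inv_ne_zero hQ0)
        (Finset.prod_ne_zero_iff.mpr fun i _ => neg_ne_zero.mpr (inv_ne_zero
          (mul_ne_zero hne (hα0 i)))))
  -- The substitution $x=e^t$ makes the difference entire; the constant part of its multiplier is
  -- $Q^{-1}$, outside $q^{\mathbb Z}$ since $Q$ is.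
  have key := eq_zero_of_theta_quasiperiodic (F := fun t => Y (exp t)) hq0 hq1 (exp_log hq0)
    (inv_ne_zero hQ0) (fun k hk => hQ (-k) (by rw [zpow_neg, ← hk, inv_inv])) hα0 Finset.univ
    (fun i _ j _ => hα i j)
    (fun t => DifferentiableAt.comp (g := Y) (f := exp) t (hYd _ (exp_ne_zero t))
      differentiableAt_exp)
    (fun t => by rw [exp_add, exp_two_pi_mul_I, mul_one])
    (fun t => by rw [exp_add, exp_log hq0, mul_comm, hYq _ (exp_ne_zero t)])
    (fun i _ k t h => by
      rw [← hY0 i k, ← h, mul_assoc, mul_inv_cancel₀ (hα0 i), mul_one]) (log x)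
  rw [exp_log hx] at key
  exact sub_eq_zero.mp key

/-! ### Holomorphic functional calculus in the `K`-ring -/

namespace KProj

variable {n : ℕ}

instance : Module.Finite ℂ (KProj n) := by
  have h : ((1 - X) ^ n : ℂ[X]) ≠ 0 := by
    refine pow_ne_zero _ fun h => ?_
    simpa using congrArg (eval 0) h
  exact (AdjoinRoot.powerBasis h).finite

instance : ContinuousAdd (KProj n) := IsModuleTopology.toContinuousAdd ℂ (KProj n)

instance : ContinuousSMul ℂ (KProj n) := IsModuleTopology.toContinuousSMul ℂ (KProj n)

instance : ContinuousMul (KProj n) := ⟨IsModuleTopology.continuous_mul_of_finite ℂ (KProj n)⟩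

instance : IsTopologicalSemiring (KProj n) where

instance : T2Space (KProj n) := by
  let L := (Module.finBasis ℂ (KProj n)).equivFun
  exact T2Space.of_injective_continuous L.injective
    (IsModuleTopology.continuous_of_linearMap L.toLinearMap)

/-- The value `f(u) = ∑_k f^{(k)}(1)/k! (u - 1)^k` at a unipotent `u` of a function holomorphic
near `1`. -/
noncomputable def evalAt (u : KProj n) (f : ℂ → ℂ) : KProj n :=
  ∑ k ∈ Finset.range n, (iteratedDeriv k f 1 / (k.factorial : ℂ)) • (u - 1) ^ k

theorem evalAt_congr (u : KProj n) {f g : ℂ → ℂ} (h : f =ᶠ[𝓝 1] g) : evalAt u f = evalAt u g := by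
  unfold evalAt
  exact Finset.sum_congr rfl fun k _ => by rw [h.iteratedDeriv_eq]

/-- Lengthening the sum lets the terms $k=0,1$ be split off whatever $n$ is. -/
theorem evalAt_eq_sum {u : KProj n} (hu : (u - 1) ^ n = 0) (f : ℂ → ℂ) {N : ℕ} (hN : n ≤ N) :
    evalAt u f = ∑ k ∈ Finset.range N, (iteratedDeriv k f 1 / (k.factorial : ℂ)) • (u - 1) ^ k := by
  refine Finset.sum_subset (Finset.range_mono hN) fun k _ hk => ?_
  rw [pow_eq_zero_of_le (by simpa using hk) hu, smul_zero]

theorem evalAt_add (u : KProj n) {f g : ℂ → ℂ} (hf : AnalyticAt ℂ f 1) (hg : AnalyticAt ℂ g 1) :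
    evalAt u (fun x => f x + g x) = evalAt u f + evalAt u g := by
  simp only [evalAt, ← Finset.sum_add_distrib, ← add_smul]
  refine Finset.sum_congr rfl fun k _ => ?_
  rw [iteratedDeriv_fun_add hf.contDiffAt hg.contDiffAt, add_div]

theorem evalAt_const {u : KProj n} (hu : (u - 1) ^ n = 0) (c : ℂ) :
    evalAt u (fun _ => c) = c • 1 := by
  rw [evalAt_eq_sum hu _ n.le_succ, Finset.sum_range_succ']
  simp [iteratedDeriv_const]

theorem evalAt_id {u : KProj n} (hu : (u - 1) ^ n = 0) : evalAt u (fun x => x) = u := by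
  rw [evalAt_eq_sum hu _ (Nat.le_add_right n 2), Finset.sum_range_succ', Finset.sum_range_succ']
  have h : ∀ k, iteratedDeriv (k + 1 + 1) (fun x : ℂ => x) 1 = 0 := fun k => by
    rw [iteratedDeriv_succ', iteratedDeriv_succ']
    simp
  simp [h]

/-- The Leibniz rule; products of total degree at least $n$ vanish by nilpotency. -/
theorem evalAt_mul {u : KProj n} (hu : (u - 1) ^ n = 0) {f g : ℂ → ℂ} (hf : AnalyticAt ℂ f 1)
    (hg : AnalyticAt ℂ g 1) : evalAt u (fun x => f x * g x) = evalAt u f * evalAt u g := by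
  let T : ℕ × ℕ → KProj n := fun p =>
    (iteratedDeriv p.1 f 1 / (p.1.factorial : ℂ)) • (u - 1) ^ p.1 *
      (iteratedDeriv p.2 g 1 / (p.2.factorial : ℂ)) • (u - 1) ^ p.2
  have hT : ∀ p, T p = (iteratedDeriv p.1 f 1 / (p.1.factorial : ℂ) *
      (iteratedDeriv p.2 g 1 / (p.2.factorial : ℂ))) • (u - 1) ^ (p.1 + p.2) := fun p => by
    simp only [T, smul_mul_smul_comm, pow_add]
  have hR : evalAt u f * evalAt u g =
      ∑ k ∈ Finset.range n, ∑ p ∈ Finset.HasAntidiagonal.antidiagonal k, T p := by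
    rw [evalAt, evalAt, Finset.sum_mul_sum, ← Finset.sum_product',
      ← Finset.sum_filter_of_ne (p := fun p : ℕ × ℕ => p.1 + p.2 < n),
      ← Finset.sum_fiberwise_of_maps_to (g := fun p : ℕ × ℕ => p.1 + p.2) (t := Finset.range n)]
    · refine Finset.sum_congr rfl fun k hk => Finset.sum_congr ?_ fun _ _ => rfl
      ext p
      simp only [Finset.mem_filter, Finset.mem_product, Finset.mem_range,
        Finset.HasAntidiagonal.mem_antidiagonal] at hk ⊢
      omega
    · intro p hp
      simpa using (Finset.mem_filter.mp hp).2
    · intro p _ hp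
      by_contra hlt
      exact hp ((hT p).trans (by rw [pow_eq_zero_of_le (not_lt.mp hlt) hu, smul_zero]))
  rw [hR, evalAt]
  refine Finset.sum_congr rfl fun k _ => ?_
  have hmul := iteratedDeriv_mul (n := k) hf.contDiffAt hg.contDiffAt
  rw [Finset.Nat.sum_antidiagonal_eq_sum_range_succ_mk]
  rw [show (fun x => f x * g x) = f * g from rfl, hmul, Finset.sum_div, Finset.sum_smul]
  refine Finset.sum_congr rfl fun i hi => ?_
  have hik : i ≤ k := Nat.lt_succ_iff.mp (Finset.mem_range.mp hi)
  rw [hT]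
  simp only [Nat.add_sub_cancel' hik]
  congr 1
  have h1 : ((k.choose i * i.factorial * (k - i).factorial : ℕ) : ℂ) = k.factorial :=
    congrArg _ (Nat.choose_mul_factorial_mul_factorial hik)
  rw [← h1]
  have h2 : (k.choose i : ℂ) ≠ 0 := Nat.cast_ne_zero.mpr (Nat.choose_pos hik).ne'
  have h3 : (i.factorial : ℂ) ≠ 0 := Nat.cast_ne_zero.mpr i.factorial_ne_zero
  have h4 : ((k - i).factorial : ℂ) ≠ 0 := Nat.cast_ne_zero.mpr (k - i).factorial_ne_zero
  push_cast
  field_simp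

theorem evalAt_const_mul {u : KProj n} (hu : (u - 1) ^ n = 0) (c : ℂ) {f : ℂ → ℂ}
    (hf : AnalyticAt ℂ f 1) : evalAt u (fun x => c * f x) = c • evalAt u f := by
  rw [evalAt_mul hu analyticAt_const hf, evalAt_const hu, smul_mul_assoc, one_mul]

theorem evalAt_sum {u : KProj n} (hu : (u - 1) ^ n = 0) {ι : Type*} (s : Finset ι) {f : ι → ℂ → ℂ}
    (hf : ∀ i ∈ s, AnalyticAt ℂ (f i) 1) :
    evalAt u (fun x => ∑ i ∈ s, f i x) = ∑ i ∈ s, evalAt u (f i) := by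
  classical
  induction s using Finset.induction_on with
  | empty => simpa using evalAt_const hu 0
  | insert a s ha ih =>
    simp only [Finset.sum_insert ha]
    rw [evalAt_add u (hf a (by simp)) (Finset.analyticAt_fun_sum _ fun i hi => hf i (by simp [hi])),
      ih fun i hi => hf i (by simp [hi])]

theorem evalAt_prod {u : KProj n} (hu : (u - 1) ^ n = 0) {ι : Type*} (s : Finset ι) {f : ι → ℂ → ℂ}
    (hf : ∀ i ∈ s, AnalyticAt ℂ (f i) 1) :
    evalAt u (fun x => ∏ i ∈ s, f i x) = ∏ i ∈ s, evalAt u (f i) := by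
  classical
  induction s using Finset.induction_on with
  | empty => simpa using evalAt_const hu 1
  | insert a s ha ih =>
    simp only [Finset.prod_insert ha]
    rw [evalAt_mul hu (hf a (by simp))
      (Finset.analyticAt_fun_prod _ fun i hi => hf i (by simp [hi])),
      ih fun i hi => hf i (by simp [hi])]

theorem evalAt_pow {u : KProj n} (hu : (u - 1) ^ n = 0) {f : ℂ → ℂ} (hf : AnalyticAt ℂ f 1)
    (k : ℕ) : evalAt u (fun x => f x ^ k) = evalAt u f ^ k := by
  simpa using evalAt_prod hu (Finset.range k) (f := fun _ => f) fun _ _ => hf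

theorem isUnit_evalAt {u : KProj n} (hu : (u - 1) ^ n = 0) {f : ℂ → ℂ} (hf : AnalyticAt ℂ f 1)
    (h : f 1 ≠ 0) : IsUnit (evalAt u f) := by
  refine IsUnit.of_mul_eq_one (evalAt u fun x => (f x)⁻¹) ?_
  rw [← evalAt_mul hu hf (hf.fun_inv h), ← one_smul ℂ (1 : KProj n), ← evalAt_const hu]
  refine evalAt_congr u ?_
  filter_upwards [hf.continuousAt.eventually_ne h] with x hx
  exact mul_inv_cancel₀ hx

/-- Locally uniform convergence of holomorphic functions passes to all derivatives, and `evalAt`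
involves finitely many of them at $1$. This carries infinite products and sums into the $K$-ring. -/
theorem tendsto_evalAt (u : KProj n) {ι : Type*} {l : Filter ι} [l.NeBot] {F : ι → ℂ → ℂ}
    {f : ℂ → ℂ} {U : Set ℂ} (hU : IsOpen U) (h1 : (1 : ℂ) ∈ U)
    (hF : ∀ i, DifferentiableOn ℂ (F i) U) (h : TendstoLocallyUniformlyOn F f l U) :
    Tendsto (fun i => evalAt u (F i)) l (𝓝 (evalAt u f)) := by
  have hd : ∀ k i, DifferentiableOn ℂ (iteratedDeriv k (F i)) U := fun k i => by
    induction k with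
    | zero => simpa using hF i
    | succ k ih =>
      rw [iteratedDeriv_succ]
      exact ih.deriv hU
  have ht : ∀ k, TendstoLocallyUniformlyOn (fun i => iteratedDeriv k (F i)) (iteratedDeriv k f) l U :=
    fun k => by
    induction k with
    | zero => simpa using h
    | succ k ih =>
      simp only [iteratedDeriv_succ]
      exact ih.deriv (Eventually.of_forall (hd k)) hU
  unfold evalAt
  refine tendsto_finsetSum _ fun k _ => ?_
  exact (((ht k).tendsto_at h1).div_const _).smul_const _

theorem qPochInf_evalAt {u : KProj n} (hu : (u - 1) ^ n = 0) {q : ℂ} (hq1 : ‖q‖ < 1)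
    {g : ℂ → ℂ} (hg : AnalyticAt ℂ g 1) :
    qPochInf q (evalAt u g) = evalAt u (fun x => qPochInf q (g x)) := by
  obtain ⟨U, hU, hUo, h1⟩ := eventually_nhds_iff.mp hg.eventually_analyticAt
  have hgU : DifferentiableOn ℂ g U := fun x hx => (hU x hx).differentiableAt.differentiableWithinAt
  have hloc : TendstoLocallyUniformlyOn (fun (s : Finset ℕ) x => ∏ k ∈ s, (1 - q ^ k • g x))
      (fun x => qPochInf q (g x)) atTop U :=
    TendstoLocallyUniformlyOn.comp (hasProdLocallyUniformlyOn_qPochInf hq1) g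
      (Set.mapsTo_univ g U) hgU.continuousOn
  have ht := tendsto_evalAt u hUo h1 (fun s => by fun_prop) hloc
  refine HasProd.tprod_eq (?_ : Tendsto _ _ _)
  refine ht.congr fun s => ?_
  rw [evalAt_prod hu _ fun k _ => by fun_prop]
  refine Finset.prod_congr rfl fun k _ => ?_
  have := evalAt_add u (f := fun _ => 1) (g := fun x => -q ^ k * g x) (by fun_prop) (by fun_prop)
  simp only [smul_eq_mul, sub_eq_add_neg, ← neg_mul]
  rw [this, evalAt_const hu, evalAt_const_mul hu _ hg, one_smul, neg_smul]

theorem qPoch_evalAt {u : KProj n} (hu : (u - 1) ^ n = 0) (q : ℂ)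
    {g : ℂ → ℂ} (hg : AnalyticAt ℂ g 1) (d : ℕ) :
    qPoch q (evalAt u g) d = evalAt u (fun x => qPoch q (g x) d) := by
  unfold qPoch
  rw [evalAt_prod hu _ fun k _ => by fun_prop]
  refine Finset.prod_congr rfl fun k _ => ?_
  have := evalAt_add u (f := fun _ => 1) (g := fun x => -q ^ k * g x) (by fun_prop) (by fun_prop)
  simp only [smul_eq_mul, sub_eq_add_neg, ← neg_mul]
  rw [this, evalAt_const hu, evalAt_const_mul hu _ hg, one_smul, neg_smul]

theorem P_sub_one_pow (n : ℕ) : (P n - 1) ^ n = 0 := by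
  rw [← neg_sub, neg_pow, one_sub_P_pow, mul_zero]

theorem Pinv_sub_one_pow (n : ℕ) : (Pinv n - 1) ^ n = 0 := by
  have : Pinv n - 1 = Pinv n * (1 - P n) := by
    linear_combination P_mul_Pinv n
  rw [this, mul_pow, one_sub_P_pow, mul_zero]

theorem evalAt_P_inv (n : ℕ) : evalAt (P n) (fun x => x⁻¹) = Pinv n := by
  have h : evalAt (P n) (fun x => x * x⁻¹) = 1 := by
    rw [← one_smul ℂ (1 : KProj n), ← evalAt_const (P_sub_one_pow n)]
    refine evalAt_congr _ ?_
    filter_upwards [isOpen_ne.mem_nhds (one_ne_zero (α := ℂ))] with x hx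
    exact mul_inv_cancel₀ hx
  rw [evalAt_mul (f := fun x => x) (P_sub_one_pow n) analyticAt_id (analyticAt_inv one_ne_zero),
    evalAt_id (P_sub_one_pow n)] at h
  exact (isUnit_P n).mul_left_cancel (h.trans (P_mul_Pinv n).symm)

theorem evalAt_P_mul (n : ℕ) (a : ℂ) : evalAt (P n) (fun x => a * x) = a • P n := by
  rw [evalAt_const_mul (f := fun x => x) (P_sub_one_pow n) a analyticAt_id, evalAt_id (P_sub_one_pow n)]

theorem evalAt_P_mul_inv (n : ℕ) (a : ℂ) : evalAt (P n) (fun x => a * x⁻¹) = a • Pinv n := by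
  rw [evalAt_const_mul (P_sub_one_pow n) a (analyticAt_inv one_ne_zero), evalAt_P_inv]

end KProj

/-! ### The connection formula in the `K`-ring -/

namespace KProj

theorem qPochInf_smul {n : ℕ} {u : KProj n} (hu : (u - 1) ^ n = 0) {q : ℂ} (hq1 : ‖q‖ < 1) (a : ℂ) :
    qPochInf q (a • u) = evalAt u fun x => qPochInf q (a * x) := by
  rw [← qPochInf_evalAt hu hq1 (by fun_prop),
    evalAt_const_mul (f := fun x => x) hu a analyticAt_id, evalAt_id hu]

theorem qPochInf_smul_P {q : ℂ} (hq1 : ‖q‖ < 1) (n : ℕ) (a : ℂ) :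
    qPochInf q (a • P n) = evalAt (P n) fun x => qPochInf q (a * x) :=
  qPochInf_smul (P_sub_one_pow n) hq1 a

theorem qPochInf_smul_Pinv {q : ℂ} (hq1 : ‖q‖ < 1) (n : ℕ) (a : ℂ) :
    qPochInf q (a • Pinv n) = evalAt (P n) fun x => qPochInf q (a * x⁻¹) := by
  rw [← evalAt_P_mul_inv, qPochInf_evalAt (P_sub_one_pow n) hq1
    (analyticAt_const.fun_mul (analyticAt_inv one_ne_zero))]

end KProj

theorem analyticAt_qPochInf_mul {q : ℂ} (hq1 : ‖q‖ < 1) (a x : ℂ) :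
    AnalyticAt ℂ (fun x => qPochInf q (a * x)) x := by
  have h := differentiable_qPochInf hq1
  have : Differentiable ℂ fun x => qPochInf q (a * x) := by fun_prop
  exact this.analyticAt x

theorem analyticAt_qPochInf_mul_inv {q : ℂ} (hq1 : ‖q‖ < 1) (a : ℂ) {x : ℂ} (hx : x ≠ 0) :
    AnalyticAt ℂ (fun x => qPochInf q (a * x⁻¹)) x :=
  ((differentiable_qPochInf hq1).analyticAt (a * x⁻¹)).comp_of_eq
    (analyticAt_const.fun_mul (analyticAt_inv hx)) rfl

namespace KProj

theorem isUnit_qPochInf_smul_P {q : ℂ} (hq1 : ‖q‖ < 1) (n : ℕ) {a : ℂ}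
    (ha : ∀ k : ℕ, q ^ k * a ≠ 1) : IsUnit (qPochInf q (a • P n)) := by
  rw [qPochInf_smul_P hq1]
  refine isUnit_evalAt (P_sub_one_pow n) (analyticAt_qPochInf_mul hq1 a 1) ?_
  rw [mul_one]
  exact qPochInf_ne_zero hq1 ha

theorem isUnit_qPochInf_smul_Pinv {q : ℂ} (hq1 : ‖q‖ < 1) (n : ℕ) {a : ℂ}
    (ha : ∀ k : ℕ, q ^ k * a ≠ 1) : IsUnit (qPochInf q (a • Pinv n)) := by
  rw [qPochInf_smul_Pinv hq1]
  refine isUnit_evalAt (P_sub_one_pow n) (analyticAt_qPochInf_mul_inv hq1 a one_ne_zero) ?_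
  rw [inv_one, mul_one]
  exact qPochInf_ne_zero hq1 ha

theorem isUnit_qPochInf_q_smul_P {q : ℂ} (hq1 : ‖q‖ < 1) (n : ℕ) :
    IsUnit (qPochInf q (q • P n)) := by
  refine isUnit_qPochInf_smul_P hq1 n fun k h => ?_
  have := congrArg norm h
  rw [← pow_succ, norm_pow, norm_one] at this
  exact (pow_lt_one₀ (norm_nonneg _) hq1 k.succ_ne_zero).ne this

theorem evalAt_qJacobi {q : ℂ} (hq1 : ‖q‖ < 1) (n : ℕ) (a : ℂ) :
    evalAt (P n) (fun x => qJacobi q (x * a)) =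
      qPochInf q (a • P n) * qPochInf q ((q / a) • Pinv n) := by
  rw [qPochInf_smul_P hq1, qPochInf_smul_Pinv hq1, ← evalAt_mul (P_sub_one_pow n)
    (analyticAt_qPochInf_mul hq1 a 1) (analyticAt_qPochInf_mul_inv hq1 _ one_ne_zero)]
  congr 1
  ext x
  rw [qJacobi, mul_comm x, div_mul_eq_div_div, div_eq_mul_inv (q / a)]

theorem evalAt_frobPhi {q : ℂ} (hq1 : ‖q‖ < 1) (n : ℕ) {m : ℕ} (α : Fin m → ℂ) :
    evalAt (P n) (fun x => frobPhi q α x⁻¹) = ∏ i, qPochInf q ((q / α i) • Pinv n) := by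
  simp only [qPochInf_smul_Pinv hq1]
  rw [← evalAt_prod (P_sub_one_pow n) _
    fun i _ => analyticAt_qPochInf_mul_inv hq1 _ one_ne_zero]
  congr 1
  ext x
  exact Finset.prod_congr rfl fun i _ => by rw [mul_div_right_comm]

/-- The splitting $(Pq;q)_\infty=(Pq;q)_d\,(Pq^{d+1};q)_\infty$ clears the denominator and leaves an
entire function evaluated at $P$. -/
theorem qSeriesTerm_mul_qPochInf {q : ℂ} (hq1 : ‖q‖ < 1) (n : ℕ) {m : ℕ} (α : Fin m → ℂ)
    (Q : ℂ) (d : ℕ) : qSeriesTerm n q α Q d * qPochInf q (q • P n) ^ n =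
      evalAt (P n) fun x => qIterTerm q (seriesPoly α) (seriesPsi n q) Q x d := by
  have hu := P_sub_one_pow n
  have ha : ∀ a, AnalyticAt ℂ (fun x : ℂ => qPoch q (a * x) d) 1 := fun a => by
    unfold qPoch
    fun_prop
  have hP : ∀ a : ℂ, qPoch q (a • P n) d = evalAt (P n) fun x => qPoch q (a * x) d := fun a => by
    rw [← evalAt_P_mul, qPoch_evalAt hu _ (by fun_prop)]
  have hsplit : qPochInf q (q • P n) =
      qPoch q (q • P n) d * evalAt (P n) (fun x => qPochInf q (q ^ (d + 1) * x)) := by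
    rw [qPochInf_smul_P hq1, hP, ← evalAt_mul hu (ha q) (analyticAt_qPochInf_mul hq1 _ 1)]
    congr 1
    ext x
    rw [qPochInf_eq_qPoch_mul hq1 (q * x) d, pow_succ, mul_assoc]
  have hunit : IsUnit (qPoch q (q • P n) d ^ n) := by
    have := isUnit_qPochInf_q_smul_P hq1 n
    rw [hsplit] at this
    exact (isUnit_of_mul_isUnit_left this).pow n
  have hR : (evalAt (P n) fun x => qIterTerm q (seriesPoly α) (seriesPsi n q) Q x d) =
      Q ^ d • ((∏ i, qPoch q (α i • P n) d) *
        evalAt (P n) (fun x => qPochInf q (q ^ (d + 1) * x)) ^ n) := by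
    simp only [hP]
    rw [← evalAt_prod hu _ fun i _ => ha (α i), ← evalAt_pow hu (analyticAt_qPochInf_mul hq1 _ 1),
      ← evalAt_mul hu (Finset.analyticAt_fun_prod _ fun i _ => ha (α i))
        ((analyticAt_qPochInf_mul hq1 _ 1).fun_pow n),
      ← evalAt_const_mul hu _ ((Finset.analyticAt_fun_prod _ fun i _ => ha (α i)).fun_mul
        ((analyticAt_qPochInf_mul hq1 _ 1).fun_pow n))]
    congr 1
    ext x
    simp only [qIterTerm, seriesPoly, seriesPsi, qPoch, smul_eq_mul]
    rw [Finset.prod_comm, pow_succ' q, mul_assoc q]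
    simp only [mul_assoc, mul_comm x]
  rw [hR, hsplit, qSeriesTerm, smul_mul_assoc, mul_pow]
  congr 1
  linear_combination (∏ i, qPoch q (α i • P n) d) *
    evalAt (P n) (fun x => qPochInf q (q ^ (d + 1) * x)) ^ n * Ring.inverse_mul_cancel _ hunit

theorem hasSum_qSeriesTerm {q : ℂ} (hq1 : ‖q‖ < 1) (n : ℕ) {m : ℕ} (α : Fin m → ℂ)
    {Q : ℂ} (hQ1 : ‖Q‖ < 1) : HasSum (qSeriesTerm n q α Q)
      (evalAt (P n) (entireQSol q (seriesPoly α) (seriesPsi n q) Q) *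
        Ring.inverse (qPochInf q (q • P n) ^ n)) := by
  have hu := P_sub_one_pow n
  have hunit := (isUnit_qPochInf_q_smul_P hq1 n).pow n
  have hp := differentiable_seriesPoly α
  have hψ := differentiable_seriesPsi hq1 n
  have hz : ‖Q‖ * ‖seriesPoly α 0‖ < 1 := by simpa [seriesPoly_zero] using hQ1
  have hterm : ∀ d, Differentiable ℂ fun x =>
      qIterTerm q (seriesPoly α) (seriesPsi n q) Q x d := fun d => by
    unfold qIterTerm
    fun_prop
  -- Radius $2$ is used only to have a disc around $0$ containing the point $1$.
  obtain ⟨u, hus, h⟩ := exists_summable_norm_qIterTerm_le hq1 hp.continuous hψ.continuous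
    (norm_nonneg Q) hz 2
  have hunif := (tendstoUniformlyOn_tsum hus (s := Metric.ball 0 2)
    (f := fun d x => qIterTerm q (seriesPoly α) (seriesPsi n q) Q x d)
    fun d x hx => h d Q x le_rfl (by simpa using (Metric.mem_ball.mp hx).le))
  have ht := tendsto_evalAt (P n) Metric.isOpen_ball
    (by simp : (1 : ℂ) ∈ Metric.ball (0 : ℂ) 2)
    (fun s => DifferentiableOn.fun_sum fun d _ => (hterm d).differentiableOn)
    hunif.tendstoLocallyUniformlyOn
  have hlim : (fun x => ∑' d, qIterTerm q (seriesPoly α) (seriesPsi n q) Q x d) =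
      entireQSol q (seriesPoly α) (seriesPsi n q) Q :=
    funext fun x => (hasSum_entireQSol hq1 hp hψ hz x).tsum_eq
  rw [hlim] at ht
  have hsum : HasSum (fun d => qSeriesTerm n q α Q d * qPochInf q (q • P n) ^ n)
      (evalAt (P n) (entireQSol q (seriesPoly α) (seriesPsi n q) Q)) := by
    refine Tendsto.congr (fun s => ?_) ht
    rw [evalAt_sum hu _ fun d _ => (hterm d).analyticAt 1]
    exact Finset.sum_congr rfl fun d _ => (qSeriesTerm_mul_qPochInf hq1 n α Q d).symm
  have := hsum.mul_right (Ring.inverse (qPochInf q (q • P n) ^ n))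
  simpa only [mul_assoc, Ring.mul_inverse_cancel _ hunit, mul_one] using this

/-- The half with $d<0$ vanishes at $P$: one use of its equation exposes the factor $(1-x^{-1})^n$,
and $(1-P^{-1})^n=0$. -/
theorem evalAt_bilateralSum {n m : ℕ} (hmn : n ≤ m) {q : ℂ} (hq1 : ‖q‖ < 1)
    {α : Fin m → ℂ} (hα0 : ∀ j, α j ≠ 0) {Q : ℂ} (hQ1 : ‖Q‖ < 1)
    (hQ : m = n → ∀ k : ℕ, Q⁻¹ * q ^ (n + k) ≠ ∏ i, α i) :
    evalAt (P n) (bilateralSum n q α Q) = (∏ i, qPochInf q ((q / α i) • Pinv n)) *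
      evalAt (P n) (entireQSol q (seriesPoly α) (seriesPsi n q) Q) := by
  have hu := P_sub_one_pow n
  have hψ := differentiable_seriesPsi hq1 n
  have hφ := differentiable_frobPhi hq1 α
  have hB := (isEntireQSol_entireQSol hq1 (differentiable_seriesPoly α) hψ (z := Q)
    (mul_pow_ne_one hq1 (by simpa [seriesPoly_zero] using hQ1))).differentiable
  have hTsol := isEntireQSol_entireQSol hq1 (differentiable_frobPoly n m q) hφ
    (frob_mul_pow_ne_one hmn hα0 hQ)
  set B := entireQSol q (seriesPoly α) (seriesPsi n q) Q
  set z := Q⁻¹ * q ^ n / ∏ i, α i with hz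
  set T := entireQSol q (frobPoly n m q) (frobPhi q α) z with hTdef
  have hinv : AnalyticAt ℂ (fun x : ℂ => x⁻¹) 1 := analyticAt_inv one_ne_zero
  have hφa : AnalyticAt ℂ (fun x => frobPhi q α x⁻¹) 1 := (hφ.analyticAt _).comp_of_eq hinv rfl
  have hTa : AnalyticAt ℂ (fun x => T (q * x⁻¹)) 1 :=
    (hTsol.differentiable.analyticAt _).comp_of_eq (analyticAt_const.fun_mul hinv) rfl
  have e : bilateralSum n q α Q = fun x => frobPhi q α x⁻¹ * B x +
      (1 + -1 * x⁻¹) ^ n * (seriesPsi n q x * (z * (-(q * x⁻¹)) ^ (m - n) * T (q * x⁻¹))) := by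
    ext x
    rw [bilateralSum, ← hz, ← hTdef, hTsol.eq x⁻¹, frobPoly]
    ring
  have h1 : AnalyticAt ℂ (fun x : ℂ => 1 + -1 * x⁻¹) 1 := by fun_prop (disch := simp)
  have h2 : AnalyticAt ℂ
      (fun x : ℂ => seriesPsi n q x * (z * (-(q * x⁻¹)) ^ (m - n) * T (q * x⁻¹))) 1 :=
    (hψ.analyticAt 1).fun_mul ((analyticAt_const.fun_mul
      ((analyticAt_const.fun_mul hinv).neg.pow (m - n))).mul hTa)
  have h3 : evalAt (P n) (fun x : ℂ => 1 + -1 * x⁻¹) = 1 - Pinv n := by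
    rw [evalAt_add _ analyticAt_const (analyticAt_const.fun_mul hinv),
      evalAt_P_mul_inv,
      evalAt_const hu, one_smul, neg_one_smul, sub_eq_add_neg]
  have h4 : (1 - Pinv n) ^ n = 0 := by
    rw [← neg_sub, neg_pow, Pinv_sub_one_pow, mul_zero]
  rw [e, evalAt_add _ (hφa.fun_mul (hB.analyticAt 1)) ((h1.fun_pow n).fun_mul h2),
    evalAt_mul hu hφa (hB.analyticAt 1), evalAt_mul hu (h1.fun_pow n) h2, evalAt_pow hu h1, h3, h4,
    zero_mul, add_zero, evalAt_frobPhi hq1]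

theorem evalAt_thetaSum (n : ℕ) {m : ℕ} {q : ℂ} (hq1 : ‖q‖ < 1)
    {α : Fin m → ℂ} (hα0 : ∀ j, α j ≠ 0) {Q : ℂ} (hQ0 : Q ≠ 0) :
    evalAt (P n) (thetaSum n q α Q) = ∑ j, thetaCoeff n q α Q j •
      ((qPochInf q ((α j * Q) • P n) * qPochInf q ((q / (α j * Q)) • Pinv n)) *
        ∏ i ∈ Finset.univ.erase j,
          (qPochInf q (α i • P n) * qPochInf q ((q / α i) • Pinv n))) := by
  have hu := P_sub_one_pow n
  have ha : ∀ a : ℂ, a ≠ 0 → AnalyticAt ℂ (fun x => qJacobi q (x * a)) 1 := fun a ha => by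
    simp only [qJacobi, mul_comm _ a, div_mul_eq_div_div, div_eq_mul_inv (q / a)]
    exact (analyticAt_qPochInf_mul hq1 a 1).mul (analyticAt_qPochInf_mul_inv hq1 _ one_ne_zero)
  have hprod : ∀ j, AnalyticAt ℂ
      (fun x => ∏ i ∈ Finset.univ.erase j, qJacobi q (x * α i)) 1 := fun j =>
    Finset.analyticAt_fun_prod _ fun i _ => ha _ (hα0 i)
  have hj : ∀ j, AnalyticAt ℂ (fun x => qJacobi q (x * α j * Q)) 1 := fun j => by
    simpa only [mul_assoc] using ha _ (mul_ne_zero (hα0 j) hQ0)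
  unfold thetaSum
  rw [evalAt_sum hu _ fun j _ => analyticAt_const.fun_mul ((hj j).fun_mul (hprod j))]
  refine Finset.sum_congr rfl fun j _ => ?_
  rw [evalAt_const_mul hu _ ((hj j).fun_mul (hprod j)), evalAt_mul hu (hj j) (hprod j),
    evalAt_prod hu _ fun i _ => ha _ (hα0 i)]
  simp only [mul_assoc _ (α j) Q, evalAt_qJacobi hq1]

end KProj

/-! ### Comparison with the expansion at infinity -/

theorem qTheta_inv_ne_zero {m : ℕ} {n : ℕ} {q : ℂ} (hq0 : q ≠ 0) (hq1 : ‖q‖ < 1) {α : Fin m → ℂ}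
    (hα0 : ∀ j, α j ≠ 0) {Q : ℂ} (hQ : IsRegularPoint n q α Q) (j : Fin m) :
    qTheta q Q⁻¹ ≠ 0 ∧ qTheta q (α j * Q⁻¹) ≠ 0 := by
  obtain ⟨hQ0, -, hQ2, hQ3, -⟩ := hQ
  refine ⟨qTheta_ne_zero hq0 hq1 (inv_ne_zero hQ0) fun k hk => hQ2 (-k) ?_,
    qTheta_ne_zero hq0 hq1 (mul_ne_zero (hα0 j) (inv_ne_zero hQ0)) fun k hk => hQ3 j (-k) ?_⟩
  · rw [← inv_inv Q, hk, inv_neg, zpow_neg]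
  · have := zpow_ne_zero k hq0
    rw [zpow_neg]
    field_simp at hk ⊢
    linear_combination hk

theorem IsRegularPoint.inv_mul_pow_ne {n m : ℕ} {q : ℂ} {α : Fin m → ℂ} {Q : ℂ}
    (hQ : IsRegularPoint n q α Q) : m = n → ∀ k : ℕ, Q⁻¹ * q ^ (n + k) ≠ ∏ i, α i :=
  fun h k hk => hQ.2.2.2.2 h k (by rw [← hk, mul_inv_cancel_left₀ hQ.1])

/-- The $q$-character in $W_j$ cancels its inverse in the scalar factor; regularity of $Q$ makes it
finite and nonzero. -/
theorem scalarFactor_mul_frobeniusSol {n m : ℕ} {q : ℂ} (hq0 : q ≠ 0) (hq1 : ‖q‖ < 1)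
    {α : Fin m → ℂ} (hα0 : ∀ j, α j ≠ 0) {Q : ℂ} (hQ : IsRegularPoint n q α Q)
    (G : Fin m → ℂ → ℂ) (j : Fin m) :
    scalarFactor n q α j Q * frobeniusSol q α G j Q⁻¹ = qPochInf q ((α j)⁻¹ * q) ^ n * G j Q⁻¹ /
      ((∏ i ∈ Finset.univ.erase j, qPochInf q (α i / α j)) * qPochInf q q) := by
  have h := qTheta_inv_ne_zero hq0 hq1 hα0 hQ j
  have hc : qChar q (α j) Q⁻¹ ≠ 0 := div_ne_zero h.1 h.2
  rw [scalarFactor, frobeniusSol, div_mul_eq_mul_div, mul_assoc, inv_mul_cancel_left₀ hc]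

/-- The value $\varphi(\alpha_j)=(q;q)_\infty\prod_{i\ne j}(q\alpha_j/\alpha_i;q)_\infty$ cancels
half of each $\theta(\alpha_i/\alpha_j)$ in the denominator of `thetaCoeff`. -/
theorem scalarFactor_mul_eq_thetaCoeff {n m : ℕ} (hmn : n ≤ m) {q : ℂ} (hq0 : q ≠ 0)
    (hq1 : ‖q‖ < 1) {α : Fin m → ℂ} (hα0 : ∀ j, α j ≠ 0)
    (hαres : ∀ i j, ∀ k : ℤ, k ≠ 0 → α i ≠ α j * q ^ k) {Q : ℂ} (hQ : IsRegularPoint n q α Q)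
    {G : Fin m → ℂ → ℂ} (hG : ∀ j, IsFrobeniusFactor n q α j (G j)) (j : Fin m) :
    scalarFactor n q α j Q * frobeniusSol q α G j Q⁻¹ *
      (qPochInf q q ^ 2 / (qPochInf q Q * qPochInf q (q / Q))) = thetaCoeff n q α Q j := by
  have hj := hα0 j
  have hφ0 := frobPhi_ne_zero hq1 hα0 hαres j
  have hGj := (hG j).eq hq0 hα0 (isFrobeniusFactor_frobeniusFactor hmn hq0 hq1 hα0 hαres j)
    hQ.inv_mul_pow_ne
  have hT : entireQSol q (frobPoly n m q) (frobPhi q α) (Q⁻¹ * q ^ n / ∏ i, α i) (α j) =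
      frobPhi q α (α j) * G j Q⁻¹ := by
    rw [hGj, frobeniusFactor, mul_div_cancel₀ _ hφ0]
  have hφ : frobPhi q α (α j) =
      qPochInf q q * ∏ i ∈ Finset.univ.erase j, qPochInf q (q / (α i / α j)) := by
    rw [frobPhi, ← Finset.mul_prod_erase _ _ (Finset.mem_univ j), mul_div_cancel_right₀ _ hj]
    simp only [div_div_eq_mul_div]
  have hΘ : ∏ i ∈ Finset.univ.erase j, qJacobi q (α i / α j) =
      (∏ i ∈ Finset.univ.erase j, qPochInf q (α i / α j)) *
        ∏ i ∈ Finset.univ.erase j, qPochInf q (q / (α i / α j)) := Finset.prod_mul_distrib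
  have hEq := qPochInf_self_ne_zero hq1
  have hD' : ∏ i ∈ Finset.univ.erase j, qPochInf q (q / (α i / α j)) ≠ 0 := by
    rw [hφ] at hφ0
    exact right_ne_zero_of_mul hφ0
  rw [scalarFactor_mul_frobeniusSol hq0 hq1 hα0 hQ, thetaCoeff, hT, hφ, hΘ, seriesPsi,
    mul_comm (α j)⁻¹ q]
  unfold qJacobi
  set D := ∏ i ∈ Finset.univ.erase j, qPochInf q (α i / α j)
  set D' := ∏ i ∈ Finset.univ.erase j, qPochInf q (q / (α i / α j))
  field_simp

theorem pow_mul_ne_one_of_ne_zpow {q a : ℂ} (ha : ∀ k : ℤ, a ≠ q ^ k) (k : ℕ) : q ^ k * a ≠ 1 := by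
  intro h
  refine ha (-k) ?_
  rw [zpow_neg, zpow_natCast]
  exact eq_inv_of_mul_eq_one_right h

theorem pow_mul_div_ne_one_of_ne_zpow {q a : ℂ} (hq0 : q ≠ 0) (ha0 : a ≠ 0)
    (ha : ∀ k : ℤ, a ≠ q ^ k) (k : ℕ) : q ^ k * (q / a) ≠ 1 := by
  intro h
  refine ha (k + 1) ?_
  field_simp at h
  rw [← h, zpow_add₀ hq0, zpow_natCast, zpow_one]

namespace KProj

theorem hasSum_qSeriesTerm_infinitySide {n m : ℕ} (hmn : n ≤ m) {q : ℂ} (hq0 : q ≠ 0)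
    (hq1 : ‖q‖ < 1) {α : Fin m → ℂ} (hα0 : ∀ j, α j ≠ 0)
    (hα : ∀ i j, i ≠ j → ∀ k : ℤ, α i ≠ α j * q ^ k)
    (hαres : ∀ i j, ∀ k : ℤ, k ≠ 0 → α i ≠ α j * q ^ k)
    (hαq : ∀ j, ∀ k : ℤ, α j ≠ q ^ k) {G : Fin m → ℂ → ℂ}
    (hG : ∀ j, IsFrobeniusFactor n q α j (G j)) {Q : ℂ} (hQ1 : ‖Q‖ < 1)
    (hQ : IsRegularPoint n q α Q) :
    HasSum (qSeriesTerm n q α Q)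
      ((∏ i, qPochInf q (α i • P n)) * Ring.inverse (qPochInf q (q • P n) ^ n) *
        ∑ j, (scalarFactor n q α j Q * frobeniusSol q α G j Q⁻¹) • thetaFactor n q (α j) Q) := by
  have hsum := hasSum_qSeriesTerm hq1 n α hQ1
  set B := evalAt (P n) (entireQSol q (seriesPoly α) (seriesPsi n q) Q)
  have hkey : (∏ i, qPochInf q ((q / α i) • Pinv n)) * B = evalAt (P n) (thetaSum n q α Q) := by
    rw [← evalAt_bilateralSum hmn hq1 hα0 hQ1 hQ.inv_mul_pow_ne]
    refine evalAt_congr _ ?_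
    filter_upwards [isOpen_ne.mem_nhds (one_ne_zero (α := ℂ))] with x hx
    exact bilateralSum_eq_thetaSum hmn hq0 hq1 hα0 hα hQ.1 hQ1 hQ.2.1 hQ.inv_mul_pow_ne hx
  rw [evalAt_thetaSum n hq1 hα0 hQ.1] at hkey
  have hu1 : ∀ i, IsUnit (qPochInf q (α i • P n)) := fun i =>
    isUnit_qPochInf_smul_P hq1 n (pow_mul_ne_one_of_ne_zpow (hαq i))
  have hu2 : ∀ i, IsUnit (qPochInf q ((q / α i) • Pinv n)) := fun i =>
    isUnit_qPochInf_smul_Pinv hq1 n (pow_mul_div_ne_one_of_ne_zpow hq0 (hα0 i) (hαq i))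
  have hB : B = (∏ i, qPochInf q (α i • P n)) *
      ∑ j, (scalarFactor n q α j Q * frobeniusSol q α G j Q⁻¹) • thetaFactor n q (α j) Q := by
    -- The condition $\alpha_i\notin q^{\mathbb Z}$ makes the products $(q/(P\alpha_i);q)_\infty$
    -- units, so they can be cancelled from the evaluated connection formula.
    have hΦ : IsUnit (∏ i, qPochInf q ((q / α i) • Pinv n)) :=
      IsUnit.prod_univ_iff.mpr hu2
    refine hΦ.mul_left_cancel ?_
    rw [hkey, Finset.mul_sum, Finset.mul_sum]
    refine Finset.sum_congr rfl fun j _ => ?_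
    have hj := Ring.mul_inverse_cancel _ ((hu1 j).mul (hu2 j))
    rw [← scalarFactor_mul_eq_thetaCoeff hmn hq0 hq1 hα0 hαres hQ hG j, thetaFactor,
      smul_smul, mul_smul_comm, mul_smul_comm]
    congr 1
    rw [← mul_assoc, ← Finset.prod_mul_distrib, ← Finset.mul_prod_erase _ _ (Finset.mem_univ j)]
    simp only [mul_comm (qPochInf q ((q / _) • Pinv n)) (qPochInf q (_ • P n))]
    linear_combination (-(qPochInf q ((α j * Q) • P n) * qPochInf q ((q / (α j * Q)) • Pinv n) *
      ∏ i ∈ Finset.univ.erase j,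
        (qPochInf q (α i • P n) * qPochInf q ((q / α i) • Pinv n)))) * hj
  rw [hB] at hsum
  rwa [mul_right_comm]

/-! ### Analyticity of `K`-valued functions -/

/-- A `K`-valued function is analytic at `z` if all its coordinates are. -/
def IsAnalyticAt {n : ℕ} (f : ℂ → KProj n) (z : ℂ) : Prop :=
  ∀ φ : KProj n →ₗ[ℂ] ℂ, AnalyticAt ℂ (fun w => φ (f w)) z

variable {n : ℕ} {f g : ℂ → KProj n} {z : ℂ}

theorem isAnalyticAt_const (a : KProj n) : IsAnalyticAt (fun _ => a) z := fun _ => analyticAt_const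

theorem IsAnalyticAt.smul {c : ℂ → ℂ} (hc : AnalyticAt ℂ c z) (hf : IsAnalyticAt f z) :
    IsAnalyticAt (fun w => c w • f w) z := fun φ => by
  simpa only [map_smul, smul_eq_mul] using hc.fun_mul (hf φ)

theorem IsAnalyticAt.sum {ι : Type*} (s : Finset ι) {f : ι → ℂ → KProj n}
    (hf : ∀ i ∈ s, IsAnalyticAt (f i) z) : IsAnalyticAt (fun w => ∑ i ∈ s, f i w) z := fun φ => by
  simpa only [map_sum] using Finset.analyticAt_fun_sum s fun i hi => hf i hi φ

theorem IsAnalyticAt.mul (hf : IsAnalyticAt f z) (hg : IsAnalyticAt g z) :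
    IsAnalyticAt (fun w => f w * g w) z := by
  let b := Module.finBasis ℂ (KProj n)
  have h : (fun w => f w * g w) =
      fun w => ∑ i, ∑ j, (b.coord i (f w) * b.coord j (g w)) • (b i * b j) := by
    ext w
    conv_lhs => rw [← b.sum_repr (f w), ← b.sum_repr (g w), Finset.sum_mul_sum]
    simp only [smul_mul_smul_comm, Module.Basis.coord_apply]
  rw [h]
  exact .sum _ fun i _ => .sum _ fun j _ =>
    .smul ((hf (b.coord i)).fun_mul (hg (b.coord j))) (isAnalyticAt_const _)

/-- In powers of $u-1$ the coefficients are $c^kE^{(k)}(c)/k!$ with $E(a)=(a;q)_\infty$, which are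
analytic wherever $c$ is. -/
theorem isAnalyticAt_qPochInf_smul {u : KProj n} (hu : (u - 1) ^ n = 0) {q : ℂ} (hq1 : ‖q‖ < 1)
    {c : ℂ → ℂ} (hc : AnalyticAt ℂ c z) : IsAnalyticAt (fun w => qPochInf q (c w • u)) z := by
  have hd := differentiable_qPochInf hq1
  have h : (fun w => qPochInf q (c w • u)) = fun w => ∑ k ∈ Finset.range n,
      (c w ^ k * iteratedDeriv k (qPochInf q) (c w) / (k.factorial : ℂ)) • (u - 1) ^ k := by
    ext w
    rw [qPochInf_smul hu hq1, evalAt]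
    refine Finset.sum_congr rfl fun k _ => ?_
    rw [iteratedDeriv_comp_const_mul hd.contDiff]
    simp only [mul_one]
  rw [h]
  have hk : ∀ k, AnalyticAt ℂ (iteratedDeriv k (qPochInf q)) (c z) := fun k => by
    rw [iteratedDeriv_eq_iterate]
    exact (hd.analyticAt (c z)).iterated_deriv k
  refine .sum _ fun k _ => .smul ?_ (isAnalyticAt_const _)
  exact ((hc.fun_pow k).fun_mul ((hk k).comp_of_eq hc rfl)).fun_div
    analyticAt_const (Nat.cast_ne_zero.mpr k.factorial_ne_zero)

end KProj

theorem analyticAt_qTheta {q : ℂ} (hq0 : q ≠ 0) (hq1 : ‖q‖ < 1) {Q : ℂ} (hQ : Q ≠ 0) :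
    AnalyticAt ℂ (qTheta q) Q :=
  DifferentiableOn.analyticAt (s := {0}ᶜ)
    (fun _ hx => (differentiableAt_qTheta hq0 hq1 hx).differentiableWithinAt)
    (isOpen_compl_singleton.mem_nhds hQ)

namespace KProj

/-- Each regularity condition handles one denominator: $-q^{\mathbb Z}$ for $\ell_q$ and the inverse
$q$-character, $-\alpha_jq^{\mathbb Z}$ for the $q$-character, $q^{\mathbb Z}$ for
$(Q,q/Q;q)_\infty$, and the condition for $m=n$ for the poles of $G_j$. -/
theorem isAnalyticAt_infinitySide {n m : ℕ} {q : ℂ} (hq0 : q ≠ 0)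
    (hq1 : ‖q‖ < 1) {α : Fin m → ℂ} (hα0 : ∀ j, α j ≠ 0)
    (hα : ∀ i j, i ≠ j → ∀ k : ℤ, α i ≠ α j * q ^ k) {G : Fin m → ℂ → ℂ}
    (hG : ∀ j, IsFrobeniusFactor n q α j (G j)) {Q : ℂ} (hQ : IsRegularPoint n q α Q) :
    IsAnalyticAt (infinitySide n q α G) Q := by
  have hQ0 := hQ.1
  have hE := differentiable_qPochInf hq1
  have hinv : AnalyticAt ℂ (fun w : ℂ => w⁻¹) Q := analyticAt_inv hQ0
  have hdiv : ∀ b : ℂ, AnalyticAt ℂ (fun w : ℂ => b / w) Q := fun b => by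
    simpa only [div_eq_mul_inv] using analyticAt_const.fun_mul hinv
  have hlog : AnalyticAt ℂ (qLog q) Q := by
    have hθ := analyticAt_qTheta hq0 hq1 hQ0
    exact (analyticAt_id.neg.mul hθ.deriv).div hθ (qTheta_ne_zero hq0 hq1 hQ0 hQ.2.2.1)
  have hpow : IsAnalyticAt (fun w => Pcpow n (qLog q w)) Q := by
    refine .sum _ fun k _ => .smul ?_ (isAnalyticAt_const _)
    refine AnalyticAt.fun_div ?_ analyticAt_const (Nat.cast_ne_zero.mpr k.factorial_ne_zero)
    exact Finset.analyticAt_fun_prod _ fun r _ => hlog.fun_sub analyticAt_const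
  refine (hpow.mul (isAnalyticAt_const _)).mul (.sum _ fun j _ => .smul ?_ (.smul ?_ (.mul
    (.mul ?_ ?_) (isAnalyticAt_const _))))
  · have hθ := qTheta_inv_ne_zero hq0 hq1 hα0 hQ j
    have hχ : AnalyticAt ℂ (fun w => qChar q (α j) w⁻¹) Q := by
      have h1 := (analyticAt_qTheta hq0 hq1 (inv_ne_zero hQ0)).comp_of_eq hinv rfl
      have h2 := (analyticAt_qTheta hq0 hq1 (mul_ne_zero (hα0 j) (inv_ne_zero hQ0))).comp_of_eq
        (analyticAt_const.fun_mul hinv) rfl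
      exact h1.div h2 hθ.2
    have hden : (∏ i ∈ Finset.univ.erase j, qPochInf q (α i / α j)) * qPochInf q q ≠ 0 := by
      refine mul_ne_zero (Finset.prod_ne_zero_iff.mpr fun i hi => qPochInf_ne_zero hq1
        (pow_mul_ne_one_of_ne_zpow fun k hk => ?_)) (qPochInf_self_ne_zero hq1)
      refine hα i j (Finset.ne_of_mem_erase hi) k ?_
      rw [← hk, mul_div_cancel₀ _ (hα0 j)]
    have hGa := ((hG j).analyticAt Q⁻¹ hQ.inv_mul_pow_ne).comp_of_eq hinv rfl
    exact ((analyticAt_const.fun_mul (hχ.fun_inv (div_ne_zero hθ.1 hθ.2))).fun_div analyticAt_const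
      hden).fun_mul (hχ.fun_mul hGa)
  · refine AnalyticAt.fun_div analyticAt_const ((hE.analyticAt Q).fun_mul
      ((hE.analyticAt (q / Q)).comp_of_eq (hdiv q) rfl)) (mul_ne_zero ?_ ?_)
    · exact qPochInf_ne_zero hq1 (pow_mul_ne_one_of_ne_zpow hQ.2.1)
    · exact qPochInf_ne_zero hq1 (pow_mul_div_ne_one_of_ne_zpow hq0 hQ0 hQ.2.1)
  · exact isAnalyticAt_qPochInf_smul (P_sub_one_pow n) hq1 (by fun_prop)
  · refine isAnalyticAt_qPochInf_smul (Pinv_sub_one_pow n) hq1 ?_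
    simpa only [div_mul_eq_div_div] using hdiv (q / α j)

end KProj

/-! ### The main theorem. -/

theorem mainTheorem1 (n m : ℕ) (hn : 1 ≤ n) (hmn : n ≤ m) (q : ℂ) (hq0 : q ≠ 0) (hq1 : ‖q‖ < 1)
    (α : Fin m → ℂ) (hα0 : ∀ j, α j ≠ 0) (hαinj : Function.Injective α)
    (hαres : ∀ i j, ∀ k : ℤ, k ≠ 0 → α i ≠ α j * q ^ k)
    (hαq : ∀ j, ∀ k : ℤ, α j ≠ q ^ k) :
    (∀ j, ∃ G : ℂ → ℂ, IsFrobeniusFactor n q α j G) ∧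
    ∀ G : Fin m → ℂ → ℂ, (∀ j, IsFrobeniusFactor n q α j (G j)) →
      (∀ Q : ℂ, IsRegularPoint n q α Q → ∀ φ : KProj n →ₗ[ℂ] ℂ,
        AnalyticAt ℂ (fun z => φ (infinitySide n q α G z)) Q) ∧
      ∀ δ : ℝ, 0 < δ → δ < Real.pi →
        ∀ Q : ℂ, ‖Q‖ < 1 → |Complex.arg (-Q)| < Real.pi - δ → IsRegularPoint n q α Q →
          Summable (qSeriesTerm n q α Q) ∧
          KProj.Pcpow n (qLog q Q) * ∑' d : ℕ, qSeriesTerm n q α Q d = infinitySide n q α G Q := by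
  have hα : ∀ i j, i ≠ j → ∀ k : ℤ, α i ≠ α j * q ^ k := fun i j hij k => by
    by_cases hk : k = 0
    · rw [hk, zpow_zero, mul_one]
      exact hαinj.ne hij
    · exact hαres i j k hk
  refine ⟨fun j => ⟨_, isFrobeniusFactor_frobeniusFactor hmn hq0 hq1 hα0 hαres j⟩,
    fun G hG => ⟨fun Q hQ => KProj.isAnalyticAt_infinitySide hq0 hq1 hα0 hα hG hQ,
      fun δ _ _ Q hQ1 _ hQ => ?_⟩⟩
  have h := KProj.hasSum_qSeriesTerm_infinitySide hmn hq0 hq1 hα0 hα hαres hαq hG hQ1 hQ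
  refine ⟨h.summable, ?_⟩
  rw [h.tsum_eq, infinitySide, mul_assoc, mul_assoc, mul_assoc]
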